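/- Let $S$ be a finite set and, for $i\in S$, let $\mathcal U_i=\{0,1,\dots,d(i)\}$ be the set of actions available in state $i$. Let $A_{ij}(a)\ge 0$ ($i,j\in S$, $a\in\mathcal U_i$), with $\sum_j A_{ij}(a)=1$, be the transition probabilities of a Markov decision process, and let $c(i,a)\in\mathbb R$ be a cost function. For angles $\alpha=(\alpha_{ip})_{i\in S,\,1\le p\le d(i)}$ define the randomized policy $\theta_{ia}(\alpha)=\lambda_{ia}^2$, where $$\lambda_{ia}=\cos(\alpha_{i,a+1})\prod_{k=1}^{a}\sin(\alpha_{ik})\quad(0\le a<d(i)),\qquad \lambda_{i,d(i)}=\prod_{k=1}^{d(i)}\sin(\alpha_{ik}),$$ and let $\boldsymbol\alpha^o$ be the interior of $\boldsymbol\alpha=\{\alpha:\ \alpha_{ip}\in[0,\pi/2]\ \text{for all } i,p\}$. Let $P(\alpha)$ be the transition matrix on the state-action pairs $(i,a)$, $a\in\mathcal U_i$, with entries $P_{(i,a),(j,a')}(\alpha)=\theta_{ja'}(\alpha)A_{ij}(a)$. Assume that the process is ergodic, in the sense that $P(\alpha)$ is irreducible for every $\alpha\in\boldsymbol\alpha^o$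 (this holds in particular if all $A_{ij}(a)$ are positive). Then for every $\alpha\in\boldsymbol\alpha^o$ the matrix $P(\alpha)$ has a unique invariant probability vector $\pi(\alpha)$; put $C(\alpha)=\sum_{i,a}\pi_{ia}(\alpha)c(i,a)$. Fix $\alpha\in\boldsymbol\alpha^o$ and let $Z_n=(X_n,u_n)$, $n\ge0$, be a Markov chain with transition matrix $P(\alpha)$ and any initial law. Then $C$ is differentiable at $\alpha$, and $\frac1N\sum_{n=1}^N c(Z_n)\to C(\alpha)$ almost surely. Moreover, fix $i\in S$ and $p\in\{1,\dots,d(i)\}$. Let $(Y_{p,k})_k$ be i.i.d. random variables (phantom actions), independent of the process $(Z_n)$, with law $$\mathbb P(Y_{p,k}=a)=\frac{\theta_{ia}(\alpha)}{\prod_{m=1}^{p}\sin^2(\alpha_{im})}\quad\text{for } p\le a\le d(i),\qquad \mathbb P(Y_{p,k}=a)=0\quad\text{for } a<p .$$ Put $$\tilde u_k=\begin{cases}Y_{p,k}, & p<d(i),\\ d(i)\,\mathbf 1\{u_k=d(i)-1\}+(d(i)-1)\,\mathbf 1\{u_k=d(i)\}, & p=d(i),\end{cases}\qquad \nu(k)=\min\{n>0:\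 Z_{k+n}=(i,\tilde u_k)\},$$ $$K_{ip}(\alpha,k)=\begin{cases}-\tan(\alpha_{ip})\,\mathbf 1\{Z_k=(i,p-1)\}, & p<d(i),\\ -\cos(\alpha_{ip})\sin(\alpha_{ip})\big[\mathbf 1\{Z_k=(i,d(i)-1)\}-\mathbf 1\{Z_k=(i,d(i))\}\big], & p=d(i).\end{cases}$$ Then, almost surely, $\nu(k)<\infty$ for all $k$. Let $\hat\Gamma_N$ be any sequence of real random variables with $\hat\Gamma_N\to C(\alpha)$ almost surely (for example $\hat\Gamma_N=\frac1N\sum_{n=1}^N c(Z_n)$). Then the estimator $$\hat G_N(i,p)=\frac2N\sum_{k=1}^N K_{ip}(\alpha,k)\Big([c(i,u_k)-c(i,\tilde u_k)]+\sum_{n=k+1}^{k+\nu(k)}c(Z_n)-\nu(k)\,\hat\Gamma_N\Big),$$ whose formula does not involve the transition probabilities $A_{ij}(a)$, is consistent: $$\hat G_N(i,p)\longrightarrow\frac{\partial C}{\partial\alpha_{ip}}(\alpha)\quad\text{almost surely as } N\to\infty .$$ (Terms with $K_{ip}(\alpha,k)=0$ are read as $0$.) -/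

import Mathlib

open MeasureTheory ProbabilityTheory Filter Topology

/-- A finite Markov decision process on the state space `S`. The actions available in state `i` are
`0, …, d i`, and `A i u j` is the probability of moving from `i` to `j` under action `u`. -/
structure MDP (S : Type*) [Fintype S] (d : S → ℕ) where
  A : (i : S) → Fin (d i + 1) → S → ℝ
  A_nonneg : ∀ i u j, 0 ≤ A i u j
  A_sum : ∀ i u, ∑ j, A i u j = 1

namespace MDP

/-- State-action pairs `(i, a)` with `a ∈ {0, …, d i}`. -/
abbrev StateAction {S : Type*} (d : S → ℕ) : Type _ := (i : S) × Fin (d i + 1)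

/-- Families of spherical coordinates `α_{ip}`, `1 ≤ p ≤ d(i)`.
The entry `α i p` with `p : Fin (d i)` is the angle usually numbered `p + 1`. -/
abbrev Angles {S : Type*} (d : S → ℕ) : Type _ := (i : S) → Fin (d i) → ℝ

/-- The compact set of angles in `[0, π/2]`. -/
def angleBox {S : Type*} (d : S → ℕ) : Set (Angles d) :=
  {α | ∀ i p, α i p ∈ Set.Icc 0 (Real.pi / 2)}

section Policy

variable {S : Type*} {d : S → ℕ}

/-- `λ_{ia} = cos α_{i,a+1} ∏_{k ≤ a} sin α_{ik}` for `a < d(i)`, and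
`λ_{i,d(i)} = ∏_{k ≤ d(i)} sin α_{ik}`. -/
noncomputable def sphericalCoord (α : Angles d) (i : S) (a : Fin (d i + 1)) : ℝ :=
  (if h : (a : ℕ) < d i then Real.cos (α i ⟨a, h⟩) else 1) *
    ∏ k ∈ Finset.univ.filter (fun k : Fin (d i) => (k : ℕ) < a), Real.sin (α i k)

/-- The spherically parameterized randomized policy `θ_{ia}(α) = λ_{ia}²`: the probability of
choosing action `a` in state `i`. -/
noncomputable def policy (α : Angles d) (i : S) (a : Fin (d i + 1)) : ℝ :=
  sphericalCoord α i a ^ 2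

/-- The law of the phantom action `Y_p`: the policy in state `i` restricted to the actions numbered
at least `p`, i.e. `θ_{ia}(α) / ∏_{m = 1}^{p} sin² α_{im}` for `a ≥ p`, and `0` for `a < p`. -/
noncomputable def phantomLaw (α : Angles d) (i : S) (p : Fin (d i)) (a : Fin (d i + 1)) : ℝ :=
  if p.succ ≤ a then policy α i a / ∏ m ∈ Finset.Iic p, Real.sin (α i m) ^ 2 else 0

variable [DecidableEq S]

/-- `δ_{ia}`: the indicator that the current state-action pair is `(i, a)`. -/
def visit (i : S) (a : Fin (d i + 1)) (z : StateAction d) : ℝ :=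
  if z = ⟨i, a⟩ then 1 else 0

/-- The weighting factor `K_{ip}(α, k)` as a function of the pair `z = Z_k`. -/
noncomputable def weight (α : Angles d) (i : S) (p : Fin (d i)) (z : StateAction d) : ℝ :=
  if (p : ℕ) + 1 < d i then - Real.tan (α i p) * visit i p.castSucc z
  else - (Real.cos (α i p) * Real.sin (α i p)) * (visit i p.castSucc z - visit i p.succ z)

/-- The action `ũ_k` of the phantom started from the pair `z = Z_k`, where `y` is the sampled value
of `Y_p`: it is `y` if `p < d(i)`; if `p = d(i)` it exchanges the actions `d(i) - 1` and `d(i)`,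
and is `0` on every other action. -/
def phantomAction (i : S) (p : Fin (d i)) (z : StateAction d) (y : Fin (d i + 1)) :
    Fin (d i + 1) :=
  if (p : ℕ) + 1 < d i then y
  else if (z.2 : ℕ) = p then p.succ
  else if (z.2 : ℕ) = p + 1 then p.castSucc
  else 0

/-- The set of times `n > 0` at which `Z_{k+n} = (i, ũ_k)`. -/
def hittingSet (i : S) (p : Fin (d i)) (z : ℕ → StateAction d) (y : ℕ → Fin (d i + 1)) (k : ℕ) :
    Set ℕ :=
  {n | 0 < n ∧ z (k + n) = ⟨i, phantomAction i p (z k) (y k)⟩}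

/-- The hitting time `ν(k) = min {n > 0 : Z_{k+n} = (i, ũ_k)}`. -/
noncomputable def hittingTime (i : S) (p : Fin (d i)) (z : ℕ → StateAction d)
    (y : ℕ → Fin (d i + 1)) (k : ℕ) : ℕ :=
  sInf (hittingSet i p z y k)

/-- The WD phantom estimator `Ĝ_N(i, p)`, computed from the parameter `α`, the cost function `c`,
the observed trajectory `z`, the sampled phantom actions `y` and an estimate `Γ` of the cost.
It does not involve the transition probabilities. (The factor `weight` vanishes unless the state of
`z k` is `i`, so that `c (z k)` is `c(i, u_k)` in every term that contributes.) -/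
noncomputable def wdPhantom (α : Angles d) (c : StateAction d → ℝ) (i : S) (p : Fin (d i))
    (z : ℕ → StateAction d) (y : ℕ → Fin (d i + 1)) (Γ : ℝ) (N : ℕ) : ℝ :=
  2 / (N : ℝ) * ∑ k ∈ Finset.Icc 1 N, weight α i p (z k) *
    ((c (z k) - c ⟨i, phantomAction i p (z k) (y k)⟩)
      + ∑ n ∈ Finset.Ioc k (k + hittingTime i p z y k), c (z n)
      - (hittingTime i p z y k : ℝ) * Γ)

end Policy

section Chain

variable {S : Type*} [Fintype S] {d : S → ℕ}

/-- The transition matrix of `Z_n = (X_n, u_n)`: from `(i, a)` to `(j, a')` with probability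
`θ_{ja'}(α) A_{ij}(a)`. -/
noncomputable def kernel (M : MDP S d) (α : Angles d) :
    Matrix (StateAction d) (StateAction d) ℝ :=
  fun z w => policy α w.1 w.2 * M.A z.1 z.2 w.1

/-- The chain of state-action pairs is irreducible for each parameter in the interior of the
parameter set. -/
def IsErgodic (M : MDP S d) : Prop :=
  ∀ α ∈ interior (angleBox d), (M.kernel α).IsIrreducible

/-- `ϖ` is an invariant probability vector of the chain with parameter `α`. -/
def IsInvariant (M : MDP S d) (α : Angles d) (ϖ : StateAction d → ℝ) : Prop :=
  ϖ ∈ stdSimplex ℝ (StateAction d) ∧ Matrix.vecMul ϖ (M.kernel α) = ϖ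

/-- The invariant probability vector `π(α)`. -/
noncomputable def statDist (M : MDP S d) (α : Angles d) : StateAction d → ℝ :=
  Classical.epsilon (M.IsInvariant α)

/-- The stationary expected cost `C(α) = ∑_{i,a} π_{ia}(α) c(i, a)`. -/
noncomputable def statCost (M : MDP S d) (c : StateAction d → ℝ) (α : Angles d) : ℝ :=
  ∑ z, M.statDist α z * c z

/-- `Z` is a Markov chain with transition matrix `kernel α` (and an arbitrary initial law). -/
def IsTrajectory (M : MDP S d) (α : Angles d) {Ω : Type*} [MeasurableSpace Ω]
    (μ : Measure Ω) (Z : ℕ → Ω → StateAction d) : Prop :=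
  (∀ n, Measurable (Z n)) ∧
  ∀ (n : ℕ) (z : ℕ → StateAction d),
    μ.real {ω | ∀ m ≤ n + 1, Z m ω = z m} =
      μ.real {ω | ∀ m ≤ n, Z m ω = z m} * M.kernel α (z n) (z (n + 1))

end Chain

/-- `Y 0, Y 1, …` are independent, each with the law of the phantom action `Y_p`, and the sequence
is independent of the trajectory `Z`. -/
def IsPhantomSequence {S : Type*} {d : S → ℕ} (α : Angles d) (i : S) (p : Fin (d i))
    {Ω : Type*} [MeasurableSpace Ω] (μ : Measure Ω) (Z : ℕ → Ω → StateAction d)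
    (Y : ℕ → Ω → Fin (d i + 1)) : Prop :=
  (∀ k, Measurable (Y k)) ∧
  (∀ k a, μ.real {ω | Y k ω = a} = phantomLaw α i p a) ∧
  iIndepFun Y μ ∧
  IndepFun (fun ω k => Y k ω) (fun ω n => Z n ω) μ

end MDP

/-! Let `h` solve the Poisson equation `h - P h = c - C`. Two facts about `h` give the theorem.

The gradient: for another parameter `β` the invariance of `π(β)` gives the exact formula `C(β) -
C(α) = π(β) (P(β) - P(α)) h`, so the derivative of `C` is `π(α) P' h`. In spherical coordinates the
derivative of the policy is a multiple of the difference between a point mass and the phantom law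
(`policyDeriv_eq`). Hence `∂C/∂α_{ip}` is twice the stationary mean of `K (h(Z) - h(i, ũ))`
(`fderiv_statCost_single`, `sum_weight_eq_deriv`).

The excursions: telescoping the Poisson equation from time `k` to the hit of the target shows that
the bracket in the estimator, with `C` in place of `Γ_N`, is `h(Z_k) - h(i, ũ_k)` plus the
increments `ξ_m = h(Z_{m+1}) - (P h)(Z_m)` over the excursion (`sum_excursion_eq`). The first term
is averaged by the ergodic theorem for the chain with independent marks. The increments are
regrouped by time: `ξ_n` gets as coefficient the total weight of the excursions in progress at time
`n`, which depends only on the history up to `n`, so a martingale transform results. Hitting times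
have geometric tails, so by Borel–Cantelli they are eventually at most `k^{1/8}`. The coefficients
are then `O(n^{1/8})`, and a strong law for orthogonal variables applies
(`ae_tendsto_average_of_orthogonal`). Excursions still unfinished at time `N` contribute only
`O(N^{1/4})`.

Replacing `C` by `Γ_N` costs `Γ_N - C` times the average of `K ν`; that average converges
(`exists_ae_tendsto_average_firstHit`), so the cost vanishes.

Phantom actions are treated as marks: the pair `(Z, Y)` is a process whose first component is Markov
with respect to the joint history, and targets and weights are functions of this pair. -/

open scoped Matrix

/-! ### Irreducible stochastic matrices: invariant vector, Poisson equation, Lyapunov function. -/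

namespace Matrix.IsIrreducible

variable {E : Type*} [Fintype E] {P : Matrix E E ℝ}

/-- A function which is subharmonic for an irreducible stochastic matrix is constant. -/
theorem eq_of_le_mulVec [DecidableEq E] (hP : P.IsIrreducible) (hs : ∀ z, ∑ w, P z w = 1)
    {x : E → ℝ} (hx : x ≤ P *ᵥ x) (z w : E) : x z = x w := by
  have key : ∀ k : ℕ, (∀ u, ∑ v, (P ^ k) u v = 1) ∧ x ≤ (P ^ k) *ᵥ x := by
    intro k
    induction k with
    | zero => simp [Matrix.one_apply]
    | succ k ih =>
      refine ⟨fun u => ?_, ?_⟩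
      · simp_rw [pow_succ, Matrix.mul_apply]
        rw [Finset.sum_comm]
        simp_rw [← Finset.mul_sum, hs, mul_one, ih.1]
      · rw [pow_succ, ← Matrix.mulVec_mulVec]
        refine ih.2.trans fun u => ?_
        exact Finset.sum_le_sum fun v _ =>
          mul_le_mul_of_nonneg_left (hx v) (Matrix.pow_apply_nonneg hP.nonneg k u v)
  have : Nonempty E := ⟨z⟩
  obtain ⟨u, hu⟩ := Finite.exists_max x
  suffices h : ∀ v, x v = x u by rw [h z, h w]
  intro v
  obtain ⟨k, -, hk⟩ := (isIrreducible_iff_exists_pow_pos hP.nonneg).1 hP u v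
  have h1 : ∑ v, (P ^ k) u v * (x u - x v) ≤ 0 := by
    have := (key k).2 u
    simp only [Matrix.mulVec, dotProduct] at this
    simp_rw [mul_sub, Finset.sum_sub_distrib, ← Finset.sum_mul, (key k).1]
    linarith
  have h2 : (P ^ k) u v * (x u - x v) ≤ ∑ v, (P ^ k) u v * (x u - x v) :=
    Finset.single_le_sum (f := fun v => (P ^ k) u v * (x u - x v))
      (fun v _ => mul_nonneg (Matrix.pow_apply_nonneg hP.nonneg k u v) (sub_nonneg.2 (hu v)))
      (Finset.mem_univ v)
  have h3 : x u - x v ≤ 0 := by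
    by_contra h
    have := mul_pos hk (not_le.1 h)
    linarith
  linarith [hu v]

/-- A stochastic matrix has an invariant probability vector. -/
theorem _root_.Matrix.exists_invariant_of_stochastic [Nonempty E] (h0 : ∀ z w, 0 ≤ P z w)
    (hs : ∀ z, ∑ w, P z w = 1) : ∃ ϖ ∈ stdSimplex ℝ E, ϖ ᵥ* P = ϖ := by
  classical
  have hdet : (1 - P).det = 0 := by
    refine Matrix.exists_mulVec_eq_zero_iff.1 ⟨1, one_ne_zero, ?_⟩
    ext z
    rw [Matrix.sub_mulVec, Matrix.one_mulVec]
    simp [Matrix.mulVec, dotProduct, hs]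
  obtain ⟨v, hv0, hv⟩ := Matrix.exists_vecMul_eq_zero_iff.2 hdet
  rw [Matrix.vecMul_sub, Matrix.vecMul_one, sub_eq_zero] at hv
  -- A left fixed vector `v` may change sign. Since `|v| ≤ |v| P` entrywise and both sides have the
  -- same total mass, equality holds, so `|v|` is itself invariant.
  have hle : ∀ w, |v w| ≤ ∑ z, |v z| * P z w := fun w => by
    conv_lhs => rw [hv]
    refine (Finset.abs_sum_le_sum_abs _ _).trans_eq (Finset.sum_congr rfl fun z _ => ?_)
    rw [abs_mul, abs_of_nonneg (h0 z w)]
  have hsum : ∑ w, |v w| = ∑ w, ∑ z, |v z| * P z w := by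
    rw [Finset.sum_comm]
    simp_rw [← Finset.mul_sum, hs, mul_one]
  have heq : ∀ w, |v w| = ∑ z, |v z| * P z w := fun w =>
    (Finset.sum_eq_sum_iff_of_le fun w _ => hle w).1 hsum w (Finset.mem_univ w)
  have hpos : 0 < ∑ w, |v w| := by
    obtain ⟨w, hw⟩ := Function.ne_iff.1 hv0
    exact Finset.sum_pos' (fun w _ => abs_nonneg _) ⟨w, Finset.mem_univ w, abs_pos.2 hw⟩
  refine ⟨fun w => |v w| / ∑ z, |v z|, ⟨fun w => by positivity, ?_⟩, ?_⟩
  · rw [← Finset.sum_div, div_self hpos.ne']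
  · ext w
    simp only [Matrix.vecMul, dotProduct]
    rw [heq w, Finset.sum_div]
    exact Finset.sum_congr rfl fun z _ => by ring

variable [DecidableEq E]

/-- The fundamental matrix `I - P + J` of a chain, where all entries of `J` are `1`. -/
def _root_.Matrix.fundamental (P : Matrix E E ℝ) : Matrix E E ℝ :=
  1 - P + Matrix.of fun _ _ => 1

theorem _root_.Matrix.fundamental_mulVec (x : E → ℝ) (z : E) :
    (P.fundamental *ᵥ x) z = x z - ∑ w, P z w * x w + ∑ w, x w := by
  rw [Matrix.fundamental, Matrix.add_mulVec, Matrix.sub_mulVec, Matrix.one_mulVec]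
  simp [Matrix.mulVec, dotProduct]

theorem _root_.Matrix.sum_mul_fundamental_mulVec {ϖ : E → ℝ} (hϖ : ϖ ∈ stdSimplex ℝ E)
    (hinv : ϖ ᵥ* P = ϖ) (x : E → ℝ) :
    ∑ z, ϖ z * (P.fundamental *ᵥ x) z = ∑ w, x w := by
  have h : ∑ z, ϖ z * ∑ w, P z w * x w = ∑ w, ϖ w * x w := by
    conv_rhs => rw [← hinv]
    simp_rw [Matrix.vecMul, dotProduct, Finset.mul_sum, Finset.sum_mul]
    rw [Finset.sum_comm]
    simp_rw [mul_assoc]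
  simp_rw [Matrix.fundamental_mulVec, mul_add, mul_sub, Finset.sum_add_distrib,
    Finset.sum_sub_distrib, h, ← Finset.sum_mul, hϖ.2]
  ring

/-- Pairing a null vector `x` with an invariant `ϖ` gives `∑ x = 0`; then `x` is harmonic, hence
constant, hence zero. -/
theorem det_fundamental_ne_zero [Nonempty E] (hP : P.IsIrreducible) (hs : ∀ z, ∑ w, P z w = 1) :
    P.fundamental.det ≠ 0 := by
  intro h
  obtain ⟨x, hx0, hx⟩ := Matrix.exists_mulVec_eq_zero_iff.2 h
  obtain ⟨ϖ, hϖ, hinv⟩ := Matrix.exists_invariant_of_stochastic hP.nonneg hs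
  have hsum := Matrix.sum_mul_fundamental_mulVec hϖ hinv x
  simp only [hx, Pi.zero_apply, mul_zero, Finset.sum_const_zero] at hsum
  have hharm : x ≤ P *ᵥ x := fun z => by
    have := congrFun hx z
    rw [Matrix.fundamental_mulVec, ← hsum] at this
    simp only [Matrix.mulVec, dotProduct]
    simp at this
    linarith
  apply hx0
  ext z
  have hc := fun w => hP.eq_of_le_mulVec hs hharm w z
  simp_rw [hc] at hsum
  simpa [Fintype.card_ne_zero] using hsum.symm

/-- The invariant probability vector is a row of the inverse of the fundamental matrix. -/
theorem eq_vecMul_inv_fundamental [Nonempty E] (hP : P.IsIrreducible)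
    (hs : ∀ z, ∑ w, P z w = 1) {ϖ : E → ℝ} (hϖ : ϖ ∈ stdSimplex ℝ E) (hinv : ϖ ᵥ* P = ϖ) :
    ϖ = 1 ᵥ* P.fundamental⁻¹ := by
  have h : ϖ ᵥ* P.fundamental = 1 := by
    ext w
    rw [Matrix.fundamental, Matrix.vecMul_add, Matrix.vecMul_sub, hinv, Matrix.vecMul_one]
    simp [Matrix.vecMul, dotProduct, hϖ.2]
  rw [← h, Matrix.vecMul_vecMul, Matrix.mul_nonsing_inv _ (hP.det_fundamental_ne_zero hs).isUnit,
    Matrix.vecMul_one]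

/-- Solvability of the Poisson equation. -/
theorem exists_poisson [Nonempty E] (hP : P.IsIrreducible)
    (hs : ∀ z, ∑ w, P z w = 1) {ϖ : E → ℝ} (hϖ : ϖ ∈ stdSimplex ℝ E) (hinv : ϖ ᵥ* P = ϖ)
    (f : E → ℝ) : ∃ h : E → ℝ, ∀ z, h z - ∑ w, P z w * h w = f z - ∑ w, ϖ w * f w := by
  set b : E → ℝ := fun z => f z - ∑ w, ϖ w * f w
  have hb : P.fundamental *ᵥ (P.fundamental⁻¹ *ᵥ b) = b := by
    rw [Matrix.mulVec_mulVec, Matrix.mul_nonsing_inv _ (hP.det_fundamental_ne_zero hs).isUnit,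
      Matrix.one_mulVec]
  refine ⟨P.fundamental⁻¹ *ᵥ b, fun z => ?_⟩
  have hsum := Matrix.sum_mul_fundamental_mulVec hϖ hinv (P.fundamental⁻¹ *ᵥ b)
  rw [hb] at hsum
  have h0 : ∑ z, ϖ z * b z = 0 := by
    simp [b, mul_sub, Finset.sum_sub_distrib, ← Finset.sum_mul, hϖ.2]
  have := congrFun hb z
  rw [Matrix.fundamental_mulVec, ← hsum, h0, add_zero] at this
  exact this

/-- If `ϖ w = 0`, the Poisson equation for the indicator of `w` makes `-h` subharmonic, so `h` is
constant and the indicator would vanish at `w`. -/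
theorem invariant_pos [Nonempty E] (hP : P.IsIrreducible)
    (hs : ∀ z, ∑ w, P z w = 1) {ϖ : E → ℝ} (hϖ : ϖ ∈ stdSimplex ℝ E) (hinv : ϖ ᵥ* P = ϖ)
    (w : E) : 0 < ϖ w := by
  refine lt_of_le_of_ne (hϖ.1 w) fun h0 => ?_
  obtain ⟨h, hh⟩ := hP.exists_poisson hs hϖ hinv (Pi.single w 1)
  have hsum : ∑ v, ϖ v * (Pi.single w 1 : E → ℝ) v = 0 := by
    simp [Pi.single_apply, ← h0]
  simp_rw [hsum, sub_zero] at hh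
  have hc := hP.eq_of_le_mulVec hs (x := -h) (fun z => by
    have h1 := hh z
    have h2 : 0 ≤ (Pi.single w 1 : E → ℝ) z := by
      rw [Pi.single_apply]; split_ifs <;> norm_num
    rw [Matrix.mulVec_neg]
    simp only [Pi.neg_apply, Matrix.mulVec, dotProduct]
    linarith)
  have h1 := hh w
  have hc' : ∀ v, h v = h w := fun v => neg_injective (hc v w)
  simp [hc', ← Finset.sum_mul, hs] at h1

/-- A Lyapunov function for the chain killed at `w`. -/
theorem exists_lyapunov [Nonempty E] (hP : P.IsIrreducible)
    (hs : ∀ z, ∑ w, P z w = 1) (w : E) :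
    ∃ (g : E → ℝ) (ρ : ℝ), 0 ≤ ρ ∧ ρ < 1 ∧ (∀ z, 1 ≤ g z) ∧
      ∀ z, ∑ v, P z v * (if v = w then 0 else g v) ≤ ρ * g z := by
  obtain ⟨ϖ, hϖ, hinv⟩ := Matrix.exists_invariant_of_stochastic hP.nonneg hs
  have hw := hP.invariant_pos hs hϖ hinv w
  obtain ⟨h, hh⟩ := hP.exists_poisson hs hϖ hinv (Pi.single w 1)
  have hsum : ∑ v, ϖ v * (Pi.single w 1 : E → ℝ) v = ϖ w := by
    simp [Pi.single_apply]
  simp_rw [hsum] at hh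
  -- This is the mean time of the first visit to `w` after time `0`: `hQ` is its one-step equation,
  -- and its value at `w` is Kac's `1 / ϖ w`.
  set g : E → ℝ := fun z => (h w - h z) / ϖ w + (Pi.single w 1 : E → ℝ) z / ϖ w with hg
  have hQ : ∀ z, ∑ v, P z v * (if v = w then 0 else g v) = g z - 1 := by
    intro z
    have : ∀ v, P z v * (if v = w then 0 else g v) = (P z v * h w - P z v * h v) / ϖ w := by
      intro v
      by_cases hv : v = w
      · simp [hv]
      · simp [hv, hg]; ring
    simp_rw [this, ← Finset.sum_div, Finset.sum_sub_distrib, ← Finset.sum_mul, hs]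
    have := hh z
    simp only [hg]
    field_simp
    linarith
  have hone : ∀ z, 1 ≤ g z := by
    obtain ⟨u, hu⟩ := Finite.exists_min g
    -- Minimum principle: at a negative minimum, killing at `w` only raises the average, so `g u ≤ g
    -- u - 1`.
    have hupos : 0 ≤ g u := by
      by_contra hneg
      have h1 : g u ≤ ∑ v, P u v * (if v = w then 0 else g v) := by
        calc g u = ∑ v, P u v * g u := by rw [← Finset.sum_mul, hs, one_mul]
          _ ≤ _ := Finset.sum_le_sum fun v _ =>
            mul_le_mul_of_nonneg_left (by split_ifs <;> linarith [hu v]) (hP.nonneg u v)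
      rw [hQ] at h1
      linarith
    intro z
    have h2 : 0 ≤ ∑ v, P z v * (if v = w then 0 else g v) :=
      Finset.sum_nonneg fun v _ => mul_nonneg (hP.nonneg z v)
        (by split_ifs <;> linarith [hu v])
    rw [hQ] at h2
    linarith
  obtain ⟨m, hm⟩ := Finite.exists_max g
  have hm1 := hone m
  -- With `g m` the maximum of `g`, the bound `g z / g m ≤ 1` turns the additive drift `g - 1` into
  -- a multiplicative contraction.
  refine ⟨g, 1 - 1 / g m, ?_, ?_, hone, fun z => ?_⟩
  · rw [sub_nonneg, div_le_one (by linarith)]; exact hm1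
  · have : 0 < 1 / g m := by positivity
    linarith
  · rw [hQ]
    have : g z / g m ≤ 1 := by rw [div_le_one (by linarith)]; exact hm z
    have e : (1 - 1 / g m) * g z = g z - g z / g m := by ring
    rw [e]; linarith

end Matrix.IsIrreducible

/-! ### A strong law for orthogonal variables of slowly growing size. -/

section OrthogonalLLN

/-- The integer part of the fourth root. -/
def Nat.fourthRoot (n : ℕ) : ℕ := Nat.sqrt (Nat.sqrt n)

theorem Nat.fourthRoot_pow_le (n : ℕ) : n.fourthRoot ^ 4 ≤ n := by
  calc n.fourthRoot ^ 4 = (n.fourthRoot ^ 2) ^ 2 := by ring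
    _ ≤ n.sqrt ^ 2 := Nat.pow_le_pow_left (Nat.sqrt_le' _) 2
    _ ≤ n := Nat.sqrt_le' n

theorem Nat.fourthRoot_mono : Monotone Nat.fourthRoot := fun _ _ h =>
  Nat.sqrt_le_sqrt (Nat.sqrt_le_sqrt h)

theorem Nat.lt_succ_fourthRoot_pow (n : ℕ) : n < (n.fourthRoot + 1) ^ 4 := by
  have h1 : n < (n.sqrt + 1) ^ 2 := Nat.lt_succ_sqrt' n
  have h2 : n.sqrt + 1 ≤ (n.fourthRoot + 1) ^ 2 := Nat.lt_succ_sqrt' n.sqrt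
  calc n < (n.sqrt + 1) ^ 2 := h1
    _ ≤ ((n.fourthRoot + 1) ^ 2) ^ 2 := Nat.pow_le_pow_left h2 2
    _ = _ := by ring

theorem Nat.fourthRoot_pow (m : ℕ) : (m ^ 4).fourthRoot = m := by
  rw [Nat.fourthRoot, show m ^ 4 = (m ^ 2) ^ 2 by ring, Nat.sqrt_eq', Nat.sqrt_eq']

theorem Nat.tendsto_fourthRoot : Tendsto Nat.fourthRoot atTop atTop :=
  tendsto_atTop_atTop.2 fun b => ⟨b ^ 4, fun a ha => by
    rw [← Nat.fourthRoot_pow b]; exact Nat.fourthRoot_mono ha⟩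

variable {Ω : Type*} [MeasurableSpace Ω] {μ : Measure Ω}

/-- Nonnegative functions with summable integrals tend to zero almost everywhere. -/
theorem ae_tendsto_zero_of_summable_integral {F : ℕ → Ω → ℝ} (hF : ∀ n, Integrable (F n) μ)
    (h0 : ∀ n ω, 0 ≤ F n ω) {u : ℕ → ℝ} (hu : Summable u) (hle : ∀ n, ∫ ω, F n ω ∂μ ≤ u n) :
    ∀ᵐ ω ∂μ, Tendsto (fun n => F n ω) atTop (𝓝 0) := by
  have hu0 : ∀ n, 0 ≤ u n := fun n => (integral_nonneg (h0 n)).trans (hle n)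
  have hsum : ∫⁻ ω, ∑' n, ENNReal.ofReal (F n ω) ∂μ ≠ ⊤ := by
    rw [lintegral_tsum fun n => (hF n).aemeasurable.ennreal_ofReal]
    refine ne_top_of_le_ne_top (hu.tsum_ofReal_ne_top) (ENNReal.tsum_le_tsum fun n => ?_)
    rw [← ofReal_integral_eq_lintegral_ofReal (hF n) (ae_of_all _ (h0 n))]
    exact ENNReal.ofReal_le_ofReal (hle n)
  have hae := ae_lt_top' (AEMeasurable.tsum
    fun n => (hF n).aemeasurable.ennreal_ofReal) hsum
  filter_upwards [hae] with ω hω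
  have h := ENNReal.tendsto_cofinite_zero_of_tsum_ne_top hω.ne
  rw [Nat.cofinite_eq_atTop] at h
  have h2 := (ENNReal.tendsto_toReal ENNReal.zero_ne_top).comp h
  simpa [Function.comp_def, ENNReal.toReal_ofReal (h0 _ ω)] using h2

/-- A strong law of large numbers for orthogonal random variables of slowly growing size. -/
theorem ae_tendsto_average_of_orthogonal [IsProbabilityMeasure μ] {X : ℕ → Ω → ℝ}
    (hm : ∀ n, Measurable (X n)) {C : ℝ}
    (hb : ∀ n ω, X n ω ^ 2 ≤ C * (n.fourthRoot + 1))
    (ho : ∀ j k, j < k → ∫ ω, X j ω * X k ω ∂μ = 0) :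
    ∀ᵐ ω ∂μ, Tendsto (fun N : ℕ => 1 / (N : ℝ) * ∑ n ∈ Finset.Ioc 0 N, X n ω) atTop (𝓝 0) := by
  have : Nonempty Ω := nonempty_of_isProbabilityMeasure μ
  have hC : 0 ≤ C := by
    obtain ⟨ω⟩ := this
    have h1 := (sq_nonneg _).trans (hb 0 ω)
    have h2 : (0 : ℝ) < (0 : ℕ).fourthRoot + 1 := by positivity
    exact nonneg_of_mul_nonneg_left h1 h2
  have habs : ∀ (n m : ℕ) (ω : Ω), n.fourthRoot ≤ m → |X n ω| ≤ √(C * (m + 1)) := fun n m ω h => by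
    refine Real.abs_le_sqrt ((hb n ω).trans ?_)
    have : (n.fourthRoot : ℝ) ≤ m := by exact_mod_cast h
    gcongr
  have hint : ∀ j k, Integrable (fun ω => X j ω * X k ω) μ := fun j k => by
    refine Integrable.of_bound (C := √(C * (j.fourthRoot + 1)) * √(C * (k.fourthRoot + 1)))
      ((hm j).mul (hm k)).aestronglyMeasurable (ae_of_all _ fun ω => ?_)
    rw [Real.norm_eq_abs, abs_mul]
    exact mul_le_mul (habs j _ ω le_rfl) (habs k _ ω le_rfl) (abs_nonneg _) (Real.sqrt_nonneg _)
  have hsq : ∀ (N : ℕ) ω, (∑ n ∈ Finset.Ioc 0 N, X n ω) ^ 2 =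
      ∑ j ∈ Finset.Ioc 0 N, ∑ k ∈ Finset.Ioc 0 N, X j ω * X k ω := fun N ω => by
    rw [sq, Finset.sum_mul_sum]
  have hSint : ∀ N : ℕ, Integrable (fun ω => (∑ n ∈ Finset.Ioc 0 N, X n ω) ^ 2) μ := fun N => by
    simp_rw [hsq]
    exact integrable_finsetSum _ fun j _ => integrable_finsetSum _ fun k _ => hint j k
  -- Orthogonality leaves only the diagonal. Along the times `m ^ 4` the normalised second moment is
  -- therefore `O(m ^ (-3))`, which is summable.
  have hS : ∀ m : ℕ, ∫ ω, (∑ n ∈ Finset.Ioc 0 (m ^ 4), X n ω) ^ 2 ∂μ ≤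
      (m : ℝ) ^ 4 * (C * (m + 1)) := by
    intro m
    simp_rw [hsq]
    rw [integral_finsetSum _ fun j _ => integrable_finsetSum _ fun k _ => hint j k]
    have : ∀ j ∈ Finset.Ioc 0 (m ^ 4), ∫ ω, ∑ k ∈ Finset.Ioc 0 (m ^ 4), X j ω * X k ω ∂μ ≤
        C * (m + 1) := by
      intro j hj
      rw [integral_finsetSum _ fun k _ => hint j k, Finset.sum_eq_single_of_mem j hj]
      · refine (integral_mono (hint j j) (integrable_const (C * (m + 1))) fun ω => ?_).trans
          (by simp)
        have h1 := hb j ω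
        have h2 : (j.fourthRoot : ℝ) ≤ m := by
          rw [← Nat.fourthRoot_pow m]
          exact_mod_cast Nat.fourthRoot_mono (Finset.mem_Ioc.1 hj).2
        calc X j ω * X j ω = X j ω ^ 2 := by ring
          _ ≤ C * (j.fourthRoot + 1) := h1
          _ ≤ C * (m + 1) := by gcongr
      · intro k _ hk
        rcases lt_or_gt_of_ne hk with h | h
        · simp_rw [mul_comm (X j _)]
          exact ho k j h
        · exact ho j k h
    refine (Finset.sum_le_sum this).trans_eq ?_
    simp
  have hsumm : Summable fun m : ℕ => 2 * C * (1 / (m : ℝ) ^ 3) :=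
    (Real.summable_one_div_nat_pow.2 (by norm_num)).mul_left _
  have hsub := ae_tendsto_zero_of_summable_integral (μ := μ)
    (F := fun m ω => ((∑ n ∈ Finset.Ioc 0 (m ^ 4), X n ω) / (m : ℝ) ^ 4) ^ 2)
    (fun m => by
      simp_rw [div_pow]
      exact (hSint _).div_const _) (fun m ω => sq_nonneg _) hsumm (fun m => by
      simp_rw [div_pow]
      rw [integral_div]
      rcases Nat.eq_zero_or_pos m with rfl | hmpos
      · simp
      have hm1 : (1 : ℝ) ≤ m := by exact_mod_cast hmpos
      rw [div_le_iff₀ (by positivity)]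
      refine (hS m).trans ?_
      have : 2 * C * (1 / (m : ℝ) ^ 3) * ((m : ℝ) ^ 4) ^ 2 = (m : ℝ) ^ 4 * (C * (2 * m)) := by
        field_simp
      rw [this]
      gcongr
      linarith)
  filter_upwards [hsub] with ω hω
  have h1 : Tendsto (fun m : ℕ => |∑ n ∈ Finset.Ioc 0 (m ^ 4), X n ω| / (m : ℝ) ^ 4)
      atTop (𝓝 0) := by
    have := hω.sqrt
    rw [Real.sqrt_zero] at this
    refine this.congr fun m => ?_
    rw [Real.sqrt_sq_eq_abs, abs_div, abs_of_nonneg (by positivity : (0 : ℝ) ≤ (m : ℝ) ^ 4)]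
  have h2 : Tendsto (fun m : ℕ => √(2 * C * (1 / (m : ℝ)))) atTop (𝓝 0) := by
    have := ((tendsto_one_div_atTop_nhds_zero_nat (𝕜 := ℝ)).const_mul (2 * C)).sqrt
    simpa using this
  have h3 := (h1.add (h2.const_mul 15)).comp Nat.tendsto_fourthRoot
  simp only [mul_zero, add_zero] at h3
  refine squeeze_zero_norm' ?_ h3
  filter_upwards [Nat.tendsto_fourthRoot.eventually_ge_atTop 1] with N hN
  simp only [Function.comp]
  set m := N.fourthRoot with hmdef
  have hm1 : (1 : ℝ) ≤ m := by exact_mod_cast hN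
  have hmN : m ^ 4 ≤ N := Nat.fourthRoot_pow_le N
  have hNm : N < (m + 1) ^ 4 := Nat.lt_succ_fourthRoot_pow N
  have hmN' : (m : ℝ) ^ 4 ≤ N := by exact_mod_cast hmN
  have hNm' : (N : ℝ) ≤ ((m : ℝ) + 1) ^ 4 := by exact_mod_cast hNm.le
  have hm4 : (0 : ℝ) < (m : ℝ) ^ 4 := by positivity
  have hsplit : |∑ n ∈ Finset.Ioc 0 N, X n ω| ≤ |∑ n ∈ Finset.Ioc 0 (m ^ 4), X n ω| +
      ((N : ℝ) - (m : ℝ) ^ 4) * √(C * (m + 1)) := by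
    rw [← Finset.sum_Ioc_consecutive _ (Nat.zero_le _) hmN]
    refine (abs_add_le _ _).trans (add_le_add le_rfl ?_)
    refine (Finset.abs_sum_le_sum_abs _ _).trans
      ((Finset.sum_le_sum fun n hn => habs n m ω
        (Nat.fourthRoot_mono (Finset.mem_Ioc.1 hn).2)).trans_eq ?_)
    simp [Nat.cast_sub hmN]
  -- The constant is `4 + 6 + 4 + 1`. A block of at most `15 m ^ 3` terms of size `O(√m)` is
  -- negligible against `m ^ 4`, which fills in the times between fourth powers.
  have hgap : (N : ℝ) - (m : ℝ) ^ 4 ≤ 15 * (m : ℝ) ^ 3 := by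
    have a1 : (m : ℝ) ^ 2 ≤ (m : ℝ) ^ 3 := pow_le_pow_right₀ hm1 (by norm_num)
    have a2 : (m : ℝ) ≤ (m : ℝ) ^ 3 := le_self_pow₀ hm1 (by norm_num)
    have a3 : (1 : ℝ) ≤ (m : ℝ) ^ 3 := one_le_pow₀ hm1
    nlinarith
  have hroot : √(C * (m + 1)) ≤ √(2 * C * (1 / (m : ℝ))) * m := by
    have : √(2 * C * (1 / (m : ℝ))) * m = √(2 * C * m) := by
      nth_rewrite 2 [← Real.sqrt_sq (by positivity : (0 : ℝ) ≤ (m : ℝ))]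
      rw [← Real.sqrt_mul (by positivity)]
      congr 1
      field_simp
    rw [this]
    apply Real.sqrt_le_sqrt
    nlinarith
  rw [Real.norm_eq_abs, abs_mul, abs_of_nonneg (by positivity : (0 : ℝ) ≤ 1 / (N : ℝ)),
    one_div_mul_eq_div]
  calc |∑ n ∈ Finset.Ioc 0 N, X n ω| / N ≤ |∑ n ∈ Finset.Ioc 0 N, X n ω| / (m : ℝ) ^ 4 := by
        gcongr
    _ ≤ (|∑ n ∈ Finset.Ioc 0 (m ^ 4), X n ω| +
        15 * (m : ℝ) ^ 3 * (√(2 * C * (1 / (m : ℝ))) * m)) / (m : ℝ) ^ 4 := by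
        gcongr
        exact hsplit.trans (by gcongr)
    _ = _ := by field_simp

end OrthogonalLLN

/-! ### Markov property, martingale transforms and hitting tails for a chain observed with extra
marks. -/

section FactorChain

theorem Finite.exists_abs_le {B : Type*} [Finite B] (F : B → ℝ) : ∃ K, 0 ≤ K ∧ ∀ b, |F b| ≤ K := by
  obtain ⟨K, hK⟩ := Set.Finite.bddAbove (Set.finite_range fun b => |F b|)
  exact ⟨max K 0, le_max_right _ _, fun b => (hK ⟨b, rfl⟩).trans (le_max_left _ _)⟩

variable {E B Ω : Type*} [Fintype E]

/-- The path which follows `v` and then stays at its last point. -/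
def stoppedPath {n : ℕ} (v : Fin (n + 1) → B) (m : ℕ) : B :=
  v ⟨min m n, Nat.lt_succ_of_le (min_le_right m n)⟩

theorem stoppedPath_eq {n : ℕ} (x : ℕ → B) {m : ℕ} (hm : m ≤ n) :
    stoppedPath (fun k : Fin (n + 1) => x k) m = x m := by
  simp [stoppedPath, hm]

/-- A function of the path up to `n` factors through the finite set of initial segments; its
measurability and boundedness come from there. -/
theorem DependsOn.apply_stoppedPath {G : (ℕ → B) → ℝ} {n : ℕ} (hG : DependsOn G (Set.Iic n))
    (x : ℕ → B) : G (stoppedPath fun k : Fin (n + 1) => x k) = G x :=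
  hG fun _ hm => stoppedPath_eq x hm

theorem DependsOn.exists_abs_le [Finite B] {G : (ℕ → B) → ℝ} {n : ℕ} (hG : DependsOn G (Set.Iic n)) :
    ∃ K, ∀ x, |G x| ≤ K := by
  obtain ⟨K, -, hK⟩ := Finite.exists_abs_le fun v : Fin (n + 1) → B => G (stoppedPath v)
  refine ⟨K, fun x => ?_⟩
  rw [← hG.apply_stoppedPath x]
  exact hK _

variable [MeasurableSpace B] [MeasurableSpace Ω]

/-- `X` is a process whose image under `pr` is a Markov chain with transition matrix `P` with
respect to the history of `X`. -/
def IsFactorChain (μ : Measure Ω) (P : Matrix E E ℝ) (pr : B → E) (X : ℕ → Ω → B) : Prop :=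
  (∀ n, Measurable (X n)) ∧ ∀ (n : ℕ) (x : ℕ → B) (w : E),
    μ.real {ω | (∀ m ≤ n, X m ω = x m) ∧ pr (X (n + 1) ω) = w} =
      μ.real {ω | ∀ m ≤ n, X m ω = x m} * P (pr (x n)) w

variable [Finite B] [DiscreteMeasurableSpace B]

theorem DependsOn.measurable_comp {G : (ℕ → B) → ℝ} {n : ℕ} (hG : DependsOn G (Set.Iic n))
    {X : ℕ → Ω → B} (hX : ∀ n, Measurable (X n)) : Measurable fun ω => G fun m => X m ω := by
  have h : (fun ω => G fun m => X m ω) =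
      (fun v : Fin (n + 1) → B => G (stoppedPath v)) ∘ fun ω k => X k ω := by
    ext ω
    exact (hG.apply_stoppedPath _).symm
  rw [h]
  exact Measurable.of_discrete.comp (measurable_pi_lambda _ fun k => hX k)

theorem DependsOn.integrable_comp {μ : Measure Ω} [IsProbabilityMeasure μ] {G : (ℕ → B) → ℝ}
    {n : ℕ} (hG : DependsOn G (Set.Iic n))
    {X : ℕ → Ω → B} (hX : ∀ n, Measurable (X n)) : Integrable (fun ω => G fun m => X m ω) μ := by
  obtain ⟨K, hK⟩ := hG.exists_abs_le
  exact Integrable.of_bound (hG.measurable_comp hX).aestronglyMeasurable K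
    (ae_of_all _ fun ω => hK _)

namespace IsFactorChain

variable {μ : Measure Ω} [IsProbabilityMeasure μ] {P : Matrix E E ℝ} {pr : B → E} {X : ℕ → Ω → B}

/-- The Markov property. -/
theorem integral_mul_next (hX : IsFactorChain μ P pr X) {n : ℕ} {G : (ℕ → B) → ℝ}
    (hG : DependsOn G (Set.Iic n)) (f : E → ℝ) :
    ∫ ω, G (fun m => X m ω) * f (pr (X (n + 1) ω)) ∂μ =
      ∫ ω, G (fun m => X m ω) * (P *ᵥ f) (pr (X n ω)) ∂μ := by
  classical
  have := Fintype.ofFinite B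
  set A : (Fin (n + 1) → B) → Set Ω := fun v => {ω | ∀ m ≤ n, X m ω = stoppedPath v m}
  have hA : ∀ v, MeasurableSet (A v) := fun v => by
    have : A v = ⋂ m, ⋂ _ : m ≤ n, X m ⁻¹' {stoppedPath v m} := by
      ext ω; simp [A]
    rw [this]
    exact MeasurableSet.iInter fun m => MeasurableSet.iInter fun _ => hX.1 m (.of_discrete)
  have hAD : ∀ v w, MeasurableSet {ω | (∀ m ≤ n, X m ω = stoppedPath v m) ∧
      pr (X (n + 1) ω) = w} := fun v w =>
    (hA v).inter ((hX.1 (n + 1)) (MeasurableSet.of_discrete (s := pr ⁻¹' {w})))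
  have hmem : ∀ v ω, ω ∈ A v ↔ v = fun k : Fin (n + 1) => X k ω := by
    intro v ω
    constructor
    · intro h
      ext k
      have := h k (Nat.lt_succ_iff.1 k.2)
      rw [this]
      simp [stoppedPath, Nat.lt_succ_iff.1 k.2]
    · rintro rfl m hm
      exact (stoppedPath_eq (fun k => X k ω) hm).symm
  -- Both integrands are expanded over the atoms of the history up to `n`, on which `G` is constant;
  -- the factor-chain identity is then applied atom by atom.
  have hL : ∀ ω, G (fun m => X m ω) * f (pr (X (n + 1) ω)) =
      ∑ v : Fin (n + 1) → B, ∑ w, {ω | (∀ m ≤ n, X m ω = stoppedPath v m) ∧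
        pr (X (n + 1) ω) = w}.indicator (fun _ => G (stoppedPath v) * f w) ω := by
    intro ω
    rw [Finset.sum_eq_single (fun k : Fin (n + 1) => X k ω),
      Finset.sum_eq_single (pr (X (n + 1) ω)), Set.indicator_of_mem,
      hG.apply_stoppedPath fun k => X k ω]
    · exact ⟨(hmem _ ω).2 rfl, rfl⟩
    · intro w _ hw
      exact Set.indicator_of_notMem (fun h => hw h.2.symm) _
    · simp
    · intro v _ hv
      exact Finset.sum_eq_zero fun w _ =>
        Set.indicator_of_notMem (fun h => hv ((hmem _ _).1 h.1)) _
    · simp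
  have hR : ∀ ω, G (fun m => X m ω) * (P *ᵥ f) (pr (X n ω)) =
      ∑ v : Fin (n + 1) → B,
        (A v).indicator (fun _ => G (stoppedPath v) * (P *ᵥ f) (pr (stoppedPath v n))) ω := by
    intro ω
    rw [Finset.sum_eq_single (fun k : Fin (n + 1) => X k ω), Set.indicator_of_mem,
      hG.apply_stoppedPath fun k => X k ω, stoppedPath_eq (fun k => X k ω) le_rfl]
    · exact (hmem _ ω).2 rfl
    · intro v _ hv
      exact Set.indicator_of_notMem (fun h => hv ((hmem _ _).1 h)) _
    · simp
  simp_rw [hL, hR]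
  rw [integral_finsetSum _ fun v _ => integrable_finsetSum _ fun w _ =>
      (integrable_const _).indicator (hAD v w),
    integral_finsetSum _ fun v _ => (integrable_const _).indicator (hA v)]
  refine Finset.sum_congr rfl fun v _ => ?_
  rw [integral_finsetSum _ fun w _ => (integrable_const _).indicator (hAD v w),
    integral_indicator_const _ (hA v)]
  simp_rw [integral_indicator_const _ (hAD v _), hX.2]
  simp only [smul_eq_mul, Matrix.mulVec, dotProduct, Finset.mul_sum]
  exact Finset.sum_congr rfl fun w _ => by ring

/-- A strong law of large numbers for martingale transforms. -/
theorem ae_tendsto_average_transform (hX : IsFactorChain μ P pr X) (f : E → ℝ)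
    {W : ℕ → (ℕ → B) → ℝ} (hW : ∀ n, DependsOn (W n) (Set.Iic n)) {C : ℝ}
    (hC : ∀ n x, W n x ^ 2 ≤ C * (n.fourthRoot + 1)) :
    ∀ᵐ ω ∂μ, Tendsto (fun N : ℕ => 1 / (N : ℝ) * ∑ n ∈ Finset.Ioc 0 N, W n (fun m => X m ω) *
      (f (pr (X (n + 1) ω)) - (P *ᵥ f) (pr (X n ω)))) atTop (𝓝 0) := by
  obtain ⟨K, hK0, hK⟩ := Finite.exists_abs_le fun p : E × E => f p.1 - (P *ᵥ f) p.2
  have hdep : ∀ n, DependsOn (fun x : ℕ → B => W n x *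
      (f (pr (x (n + 1))) - (P *ᵥ f) (pr (x n)))) (Set.Iic (n + 1)) := by
    intro n x y hxy
    have h1 : W n x = W n y := hW n fun m hm => hxy m (Set.mem_Iic.2 (Nat.le_succ_of_le hm))
    simp only [h1, hxy n (Set.mem_Iic.2 n.le_succ), hxy (n + 1) (Set.mem_Iic.2 le_rfl)]
  refine ae_tendsto_average_of_orthogonal (C := C * K ^ 2)
    (fun n => (hdep n).measurable_comp hX.1) (fun n ω => ?_) (fun j k hjk => ?_)
  · rw [mul_pow, mul_right_comm]
    have h1 := hC n fun m => X m ω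
    refine mul_le_mul h1 ?_ (sq_nonneg _) ((sq_nonneg _).trans h1)
    exact sq_le_sq.2 ((hK (pr (X (n + 1) ω), pr (X n ω))).trans (le_abs_self K))
  -- For `j < k` the earlier summand times `W k` is determined by the history up to `k`, so the last
  -- increment integrates to zero against it.
  · set G : (ℕ → B) → ℝ := fun x =>
      (W j x * (f (pr (x (j + 1))) - (P *ᵥ f) (pr (x j)))) * W k x
    have hG : DependsOn G (Set.Iic k) := fun x y hxy => by
      have h1 := hdep j fun m (hm : m ≤ j + 1) => hxy m (Set.mem_Iic.2 (hm.trans hjk))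
      have h2 := hW k hxy
      simp only [G]
      rw [h2]
      exact congrArg (· * _) h1
    have h1 : ∀ F : E → ℝ, Integrable (fun ω => G (fun m => X m ω) * F (pr (X (k + 1) ω))) μ := by
      intro F
      refine DependsOn.integrable_comp (n := k + 1) (G := fun x => G x * F (pr (x (k + 1))))
        (fun x y hxy => ?_) hX.1
      have := hG fun m (hm : m ≤ k) => hxy m (Set.mem_Iic.2 (Nat.le_succ_of_le hm))
      simp only [this, hxy (k + 1) (Set.mem_Iic.2 le_rfl)]
    have h2 : ∀ F : E → ℝ, Integrable (fun ω => G (fun m => X m ω) * F (pr (X k ω))) μ := by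
      intro F
      refine DependsOn.integrable_comp (n := k) (G := fun x => G x * F (pr (x k)))
        (fun x y hxy => ?_) hX.1
      simp only [hG hxy, hxy k (Set.mem_Iic.2 le_rfl)]
    calc _ = ∫ ω, (G (fun m => X m ω) * f (pr (X (k + 1) ω)) -
          G (fun m => X m ω) * (P *ᵥ f) (pr (X k ω))) ∂μ := by
          refine integral_congr_ae (ae_of_all _ fun ω => ?_)
          simp only [G]; ring
      _ = 0 := by rw [integral_sub (h1 _) (h2 _), hX.integral_mul_next hG, sub_self]

/-- The ergodic theorem for an irreducible finite chain with any initial law. -/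
theorem ae_tendsto_average (hX : IsFactorChain μ P pr X) (hP : P.IsIrreducible)
    (hs : ∀ z, ∑ w, P z w = 1) {ϖ : E → ℝ} (hϖ : ϖ ∈ stdSimplex ℝ E) (hinv : ϖ ᵥ* P = ϖ)
    (f : E → ℝ) :
    ∀ᵐ ω ∂μ, Tendsto (fun N : ℕ => 1 / (N : ℝ) * ∑ n ∈ Finset.Ioc 0 N, f (pr (X n ω)))
      atTop (𝓝 (∑ z, ϖ z * f z)) := by
  classical
  have : Nonempty E := by
    obtain ⟨ω⟩ := nonempty_of_isProbabilityMeasure μ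
    exact ⟨pr (X 0 ω)⟩
  obtain ⟨h, hh⟩ := hP.exists_poisson hs hϖ hinv f
  obtain ⟨K, hK0, hK⟩ := Finite.exists_abs_le h
  filter_upwards [hX.ae_tendsto_average_transform h (W := fun _ _ => 1) (C := 1)
    (fun n x y _ => rfl) (fun n x => by simp)] with ω hω
  have hb : Tendsto (fun N : ℕ => 1 / (N : ℝ) * (h (pr (X 1 ω)) - h (pr (X (N + 1) ω))))
      atTop (𝓝 0) := by
    have h1 : Tendsto (fun N : ℕ => 1 / (N : ℝ) * (2 * K)) atTop (𝓝 0) := by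
      simpa using (tendsto_one_div_atTop_nhds_zero_nat (𝕜 := ℝ)).mul_const (2 * K)
    refine squeeze_zero_norm (fun N => ?_) h1
    rw [Real.norm_eq_abs, abs_mul, abs_of_nonneg (by positivity : (0 : ℝ) ≤ 1 / (N : ℝ))]
    refine mul_le_mul_of_nonneg_left ?_ (by positivity)
    have a1 := abs_le.1 (hK (pr (X 1 ω)))
    have a2 := abs_le.1 (hK (pr (X (N + 1) ω)))
    rw [abs_le]
    constructor <;> linarith
  have hlim := (hω.add hb).add_const (∑ z, ϖ z * f z)
  rw [add_zero, zero_add] at hlim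
  refine hlim.congr' ?_
  filter_upwards [eventually_gt_atTop 0] with N hN
  -- Summing the Poisson equation: martingale part, bounded boundary term, and `N` times the
  -- stationary mean.
  have key : ∀ N : ℕ, ∑ n ∈ Finset.Ioc 0 N, f (pr (X n ω)) =
      ∑ n ∈ Finset.Ioc 0 N, 1 * (h (pr (X (n + 1) ω)) - (P *ᵥ h) (pr (X n ω))) +
        (h (pr (X 1 ω)) - h (pr (X (N + 1) ω))) + N * ∑ z, ϖ z * f z := by
    intro N
    induction N with
    | zero => simp
    | succ N ih =>
      rw [Finset.sum_Ioc_succ_top (Nat.zero_le _), Finset.sum_Ioc_succ_top (Nat.zero_le _), ih]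
      have := hh (pr (X (N + 1) ω))
      simp only [Matrix.mulVec, dotProduct] at this ⊢
      push_cast
      linarith
  rw [key N]
  have : (N : ℝ) ≠ 0 := by exact_mod_cast hN.ne'
  field_simp

/-- Hitting times have geometric tails. -/
theorem exists_measure_avoid_le (hX : IsFactorChain μ P pr X) (hP : P.IsIrreducible)
    (hs : ∀ z, ∑ w, P z w = 1) (w : E) :
    ∃ C ρ : ℝ, 0 < ρ ∧ ρ < 1 ∧ ∀ k j : ℕ,
      μ.real {ω | ∀ m ∈ Finset.Ioc k (k + j), pr (X m ω) ≠ w} ≤ C * ρ ^ j := by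
  classical
  have : Nonempty E := ⟨w⟩
  obtain ⟨g, ρ, hρ0, hρ1, hg1, hg⟩ := hP.exists_lyapunov hs w
  obtain ⟨K, hK0, hK⟩ := Finite.exists_abs_le g
  set G : ℕ → ℕ → (ℕ → B) → ℝ := fun k n x =>
    if ∀ m ∈ Finset.Ioc k n, pr (x m) ≠ w then 1 else 0
  have hG : ∀ k n, DependsOn (G k n) (Set.Iic n) := fun k n x y hxy => by
    have : (∀ m ∈ Finset.Ioc k n, pr (x m) ≠ w) ↔ ∀ m ∈ Finset.Ioc k n, pr (y m) ≠ w :=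
      forall₂_congr fun m hm => by rw [hxy m (Finset.mem_Ioc.1 hm).2]
    simp only [G, this]
  have hG0 : ∀ k n x, 0 ≤ G k n x := fun k n x => by
    simp only [G]; split_ifs <;> norm_num
  have hGg : ∀ k n (F : E → ℝ), Integrable (fun ω => G k n (fun m => X m ω) * F (pr (X n ω))) μ :=
    fun k n F => DependsOn.integrable_comp (n := n) (G := fun x => G k n x * F (pr (x n)))
      (fun x y hxy => by simp only [hG k n hxy, hxy n (Set.mem_Iic.2 le_rfl)]) hX.1
  -- The integral of `g` over the paths avoiding `w` contracts by `ρ` at each step: avoiding `w`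
  -- once more amounts to replacing `g` by its killed version before the Markov property is used.
  have hstep : ∀ k j, ∫ ω, G k (k + j) (fun m => X m ω) * g (pr (X (k + j) ω)) ∂μ ≤ K * ρ ^ j := by
    intro k j
    induction j with
    | zero =>
      have : ∀ ω, G k (k + 0) (fun m => X m ω) * g (pr (X (k + 0) ω)) ≤ K := fun ω => by
        have : G k (k + 0) (fun m => X m ω) = 1 :=
          if_pos fun m hm => by simp at hm
        rw [this, one_mul]
        exact (le_abs_self _).trans (hK _)
      refine (integral_mono (hGg k (k + 0) g) (integrable_const K) this).trans (by simp)
    | succ j ih =>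
      have h1 : ∀ ω, G k (k + (j + 1)) (fun m => X m ω) * g (pr (X (k + (j + 1)) ω)) =
          G k (k + j) (fun m => X m ω) * (fun v => if v = w then 0 else g v)
            (pr (X (k + j + 1) ω)) := by
        intro ω
        have e : Finset.Ioc k (k + j + 1) = insert (k + j + 1) (Finset.Ioc k (k + j)) := by
          ext m; simp only [Finset.mem_Ioc, Finset.mem_insert]; omega
        simp only [G, ← add_assoc, e, Finset.forall_mem_insert]
        by_cases h : pr (X (k + j + 1) ω) = w <;> simp [h]
      rw [integral_congr_ae (ae_of_all _ h1),
        hX.integral_mul_next (hG k (k + j)) (fun v => if v = w then 0 else g v)]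
      calc _ ≤ ∫ ω, ρ * (G k (k + j) (fun m => X m ω) * g (pr (X (k + j) ω))) ∂μ := by
            refine integral_mono (hGg _ _ _) ((hGg _ _ _).const_mul _) fun ω => ?_
            calc _ ≤ G k (k + j) (fun m => X m ω) * (ρ * g (pr (X (k + j) ω))) :=
                  mul_le_mul_of_nonneg_left (hg _) (hG0 _ _ _)
              _ = _ := by ring
        _ ≤ ρ * (K * ρ ^ j) := by
            rw [integral_const_mul]
            exact mul_le_mul_of_nonneg_left ih hρ0
        _ = _ := by ring
  -- The Lyapunov rate may be `0`; the maximum with `1 / 2` makes it strictly positive.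
  refine ⟨K, max ρ (1 / 2), by positivity, by simp [hρ1]; norm_num, fun k j => ?_⟩
  have hmeas : MeasurableSet {ω | ∀ m ∈ Finset.Ioc k (k + j), pr (X m ω) ≠ w} := by
    have : {ω | ∀ m ∈ Finset.Ioc k (k + j), pr (X m ω) ≠ w} =
        ⋂ m ∈ Finset.Ioc k (k + j), X m ⁻¹' (pr ⁻¹' {w}ᶜ) := by
      ext ω; simp
    rw [this]
    exact Finset.measurableSet_biInter _ fun m _ => hX.1 m .of_discrete
  calc μ.real {ω | ∀ m ∈ Finset.Ioc k (k + j), pr (X m ω) ≠ w}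
      = ∫ ω, {ω | ∀ m ∈ Finset.Ioc k (k + j), pr (X m ω) ≠ w}.indicator 1 ω ∂μ :=
        (integral_indicator_one hmeas).symm
    _ ≤ ∫ ω, G k (k + j) (fun m => X m ω) * g (pr (X (k + j) ω)) ∂μ := by
        refine integral_mono ((integrable_const (1 : ℝ)).indicator hmeas) (hGg _ _ _) fun ω => ?_
        by_cases h : ω ∈ {ω | ∀ m ∈ Finset.Ioc k (k + j), pr (X m ω) ≠ w}
        · have : G k (k + j) (fun m => X m ω) = 1 := if_pos h
          simp only [Set.indicator_of_mem h, this, one_mul]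
          exact hg1 _
        · simp only [Set.indicator_of_notMem h]
          exact mul_nonneg (hG0 _ _ _) (zero_le_one.trans (hg1 _))
    _ ≤ K * ρ ^ j := hstep k j
    _ ≤ K * max ρ (1 / 2) ^ j := by gcongr; exact le_max_left _ _

end IsFactorChain
end FactorChain

/-! ### Deterministic estimates on excursions along one path. -/

section FirstHit

/-- The integer part of the eighth root. -/
def Nat.eighthRoot (n : ℕ) : ℕ := Nat.sqrt n.fourthRoot

theorem Nat.eighthRoot_mono : Monotone Nat.eighthRoot := fun _ _ h =>
  Nat.sqrt_le_sqrt (Nat.fourthRoot_mono h)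

theorem Nat.eighthRoot_sq_le (n : ℕ) : n.eighthRoot ^ 2 ≤ n.fourthRoot := Nat.sqrt_le' _

theorem Nat.succ_le_succ_eighthRoot_pow (n : ℕ) : n + 1 ≤ (n.eighthRoot + 1) ^ 8 := by
  have h2 : n.fourthRoot + 1 ≤ (n.eighthRoot + 1) ^ 2 := Nat.lt_succ_sqrt' _
  calc n + 1 ≤ (n.fourthRoot + 1) ^ 4 := Nat.lt_succ_fourthRoot_pow n
    _ ≤ ((n.eighthRoot + 1) ^ 2) ^ 4 := Nat.pow_le_pow_left h2 4
    _ = _ := by ring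

/-- With `b` the eighth root, `(n + 1) ^ 2 ≤ (b + 1) ^ 16`, and `(b + 1) ^ 16 * ρ ^ (b + 1)` is
bounded, so the terms are `O(n ^ (-2))`. This feeds Borel–Cantelli. -/
theorem summable_pow_eighthRoot {ρ : ℝ} (h0 : 0 < ρ) (h1 : ρ < 1) :
    Summable fun n : ℕ => ρ ^ n.eighthRoot := by
  have hlim := tendsto_pow_const_mul_const_pow_of_abs_lt_one 16 (abs_lt.2 ⟨by linarith, h1⟩)
  obtain ⟨K, hK⟩ := hlim.bddAbove_range
  have hs : Summable fun n : ℕ => K / ρ * (1 / ((n : ℝ) + 1) ^ 2) := by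
    refine Summable.mul_left _ ?_
    have := (summable_nat_add_iff 1).2 (Real.summable_one_div_nat_pow.2 one_lt_two)
    simpa using this
  refine Summable.of_nonneg_of_le (fun n => by positivity) (fun n => ?_) hs
  have h2 := hK ⟨n.eighthRoot + 1, rfl⟩
  simp only [] at h2
  have h3 : ((n : ℝ) + 1) ^ 2 ≤ ((n.eighthRoot + 1 : ℕ) : ℝ) ^ 16 := by
    calc ((n : ℝ) + 1) ^ 2 ≤ ((((n.eighthRoot + 1) ^ 8 : ℕ)) : ℝ) ^ 2 := by
          gcongr
          exact_mod_cast Nat.succ_le_succ_eighthRoot_pow n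
      _ = _ := by push_cast; ring
  rw [mul_one_div, div_div, le_div_iff₀ (by positivity)]
  calc ρ ^ n.eighthRoot * (ρ * ((n : ℝ) + 1) ^ 2)
      = ((n : ℝ) + 1) ^ 2 * ρ ^ (n.eighthRoot + 1) := by ring
    _ ≤ ((n.eighthRoot + 1 : ℕ) : ℝ) ^ 16 * ρ ^ (n.eighthRoot + 1) := by gcongr
    _ ≤ K := h2

/-- The end effect at time `N`: at most `N^{1/8}` unfinished excursions, each of length at most
`N^{1/8}`. -/
theorem tendsto_eighthRoot_sq_div : Tendsto (fun N : ℕ => 1 / (N : ℝ) * (N.eighthRoot : ℝ) ^ 2)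
    atTop (𝓝 0) := by
  have h := (tendsto_one_div_atTop_nhds_zero_nat (𝕜 := ℝ)).comp Nat.tendsto_fourthRoot
  refine squeeze_zero' (Eventually.of_forall fun N => by positivity) ?_ h
  filter_upwards [Nat.tendsto_fourthRoot.eventually_ge_atTop 1] with N hN
  have h1 : (1 : ℝ) ≤ N.fourthRoot := by exact_mod_cast hN
  have h2 : (N.fourthRoot : ℝ) ^ 4 ≤ N := by exact_mod_cast Nat.fourthRoot_pow_le N
  have h3 : (N.eighthRoot : ℝ) ^ 2 ≤ N.fourthRoot := by exact_mod_cast Nat.eighthRoot_sq_le N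
  have h4 : (N.fourthRoot : ℝ) ^ 2 ≤ (N.fourthRoot : ℝ) ^ 4 := pow_le_pow_right₀ h1 (by norm_num)
  have h5 : (0 : ℝ) < N := by nlinarith
  simp only [Function.comp]
  rw [one_div_mul_eq_div, div_le_div_iff₀ h5 (by linarith)]
  nlinarith

variable {E B : Type*}

/-- The first `n > 0` at which the path `z` is at `w` at time `k + n`. -/
noncomputable def firstHit (z : ℕ → E) (w : E) (k : ℕ) : ℕ := sInf {n | 0 < n ∧ z (k + n) = w}

variable {z : ℕ → E} {w : E} {k : ℕ}

theorem firstHit_mem (h : {n | 0 < n ∧ z (k + n) = w}.Nonempty) :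
    0 < firstHit z w k ∧ z (k + firstHit z w k) = w := Nat.sInf_mem h

/-- Whether an excursion is still running at time `n ≥ k` can be read off the path up to `n`; this
makes `activeWeight` a predictable coefficient. The start `k` is excluded from the window, as a
visit at time `k` is not a hit. -/
theorem avoid_iff_lt_add_firstHit (h : {n | 0 < n ∧ z (k + n) = w}.Nonempty) {n : ℕ} :
    (∀ m ∈ Finset.Ioc k n, z m ≠ w) ↔ n < k + firstHit z w k := by
  constructor
  · intro hn
    by_contra hlt
    exact hn (k + firstHit z w k)
      (Finset.mem_Ioc.2 ⟨Nat.lt_add_of_pos_right (firstHit_mem h).1, not_lt.1 hlt⟩)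
      (firstHit_mem h).2
  · intro hlt m hm hz
    rw [Finset.mem_Ioc] at hm
    have : firstHit z w k ≤ m - k :=
      Nat.sInf_le ⟨by omega, by rwa [Nat.add_sub_cancel' hm.1.le]⟩
    omega

/-- The total weight of the excursions in progress at time `n`. -/
noncomputable def activeWeight (pr : B → E) (T : B → E) (q : B → ℝ) (n : ℕ) (x : ℕ → B) : ℝ :=
  open Classical in ∑ k ∈ Finset.Ioc 0 n,
    if ∀ m ∈ Finset.Ioc k n, pr (x m) ≠ T (x k) then q (x k) else 0

theorem dependsOn_activeWeight (pr : B → E) (T : B → E) (q : B → ℝ) (n : ℕ) :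
    DependsOn (activeWeight pr T q n) (Set.Iic n) := by
  classical
  intro x y hxy
  refine Finset.sum_congr rfl fun k hk => ?_
  have hk' : x k = y k := hxy k (Finset.mem_Ioc.1 hk).2
  have : (∀ m ∈ Finset.Ioc k n, pr (x m) ≠ T (x k)) ↔
      ∀ m ∈ Finset.Ioc k n, pr (y m) ≠ T (y k) :=
    forall₂_congr fun m hm => by rw [hxy m (Finset.mem_Ioc.1 hm).2, hk']
  exact if_congr this (by rw [hk']) rfl

variable {pr : B → E} {T : B → E} {q : B → ℝ} {κ : ℝ} {x : ℕ → B}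

/-- The finitely many excursions started before the bound takes effect are over once `n` is large;
every later one running at time `n` has length at most `n^{1/8}`, so it began within the last
`n^{1/8}` steps. -/
theorem eventually_active_subset
    (hev : ∀ᶠ k in atTop, ∀ w, firstHit (fun m => pr (x m)) w k ≤ k.eighthRoot) :
    ∀ᶠ n in atTop, ∀ k ∈ Finset.Ioc 0 n, n < k + firstHit (fun m => pr (x m)) (T (x k)) k →
      k ∈ Finset.Ioc (n - n.eighthRoot) n ∧
        firstHit (fun m => pr (x m)) (T (x k)) k ≤ n.eighthRoot := by
  obtain ⟨k₀, hk₀⟩ := eventually_atTop.1 hev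
  have hearly : ∀ᶠ n in atTop, ∀ k ∈ Finset.range k₀,
      k + firstHit (fun m => pr (x m)) (T (x k)) k ≤ n :=
    (Finset.eventually_all _).2 fun k _ => eventually_ge_atTop _
  filter_upwards [hearly] with n hn k hk hlt
  rw [Finset.mem_Ioc] at hk
  have hkk₀ : k₀ ≤ k := by
    by_contra h
    have := hn k (Finset.mem_range.2 (not_le.1 h))
    omega
  have h1 := (hk₀ k hkk₀ (T (x k))).trans (Nat.eighthRoot_mono hk.2)
  exact ⟨Finset.mem_Ioc.2 ⟨by omega, hk.2⟩, h1⟩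

theorem card_Ioc_sub_le (n b : ℕ) : ((Finset.Ioc (n - b) n).card : ℝ) ≤ b := by
  rw [Nat.card_Ioc]
  exact_mod_cast (by omega : n - (n - b) ≤ b)

/-- At most `n^{1/8}` excursions are running at time `n`, and each has weight at most `κ`. -/
theorem eventually_abs_activeWeight_le (hκ : 0 ≤ κ) (hq : ∀ b, |q b| ≤ κ)
    (hne : ∀ w k, {n | 0 < n ∧ pr (x (k + n)) = w}.Nonempty)
    (hev : ∀ᶠ k in atTop, ∀ w, firstHit (fun m => pr (x m)) w k ≤ k.eighthRoot) :
    ∀ᶠ n in atTop, |activeWeight pr T q n x| ≤ κ * n.eighthRoot := by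
  classical
  filter_upwards [eventually_active_subset (T := T) hev] with n hn
  calc |activeWeight pr T q n x| ≤ ∑ k ∈ Finset.Ioc 0 n,
        |if ∀ m ∈ Finset.Ioc k n, pr (x m) ≠ T (x k) then q (x k) else 0| := by
        refine (Finset.abs_sum_le_sum_abs _ _).trans_eq (Finset.sum_congr rfl fun k _ => ?_)
        congr
    _ ≤ ∑ k ∈ Finset.Ioc 0 n, if k ∈ Finset.Ioc (n - n.eighthRoot) n then κ else 0 := by
        refine Finset.sum_le_sum fun k hk => ?_
        by_cases h : ∀ m ∈ Finset.Ioc k n, pr (x m) ≠ T (x k)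
        · rw [if_pos h, if_pos]
          · exact hq _
          · exact (hn k hk ((avoid_iff_lt_add_firstHit (z := fun m => pr (x m)) (hne _ k)).1 h)).1
        · rw [if_neg h, abs_zero]
          split_ifs <;> simp [hκ]
    _ = (Finset.Ioc 0 n ∩ Finset.Ioc (n - n.eighthRoot) n).card * κ := by
        rw [Finset.sum_ite_mem]
        simp
    _ ≤ κ * n.eighthRoot := by
        rw [mul_comm]
        refine mul_le_mul_of_nonneg_left (le_trans ?_ (card_Ioc_sub_le n n.eighthRoot)) hκ
        exact_mod_cast Finset.card_le_card Finset.inter_subset_right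

/-- Summation by parts: the excursions started before `N`, grouped by their steps. -/
theorem tendsto_excursion_sub {ξ : ℕ → ℝ} {Ξ : ℝ} (hκ : 0 ≤ κ) (hq : ∀ b, |q b| ≤ κ)
    (hξ : ∀ n, |ξ n| ≤ Ξ) (hne : ∀ w k, {n | 0 < n ∧ pr (x (k + n)) = w}.Nonempty)
    (hev : ∀ᶠ k in atTop, ∀ w, firstHit (fun m => pr (x m)) w k ≤ k.eighthRoot) :
    Tendsto (fun N : ℕ => 1 / (N : ℝ) * (∑ k ∈ Finset.Ioc 0 N, q (x k) *
        ∑ m ∈ Finset.Ico k (k + firstHit (fun m => pr (x m)) (T (x k)) k), ξ m -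
      ∑ n ∈ Finset.Ioc 0 N, activeWeight pr T q n x * ξ n)) atTop (𝓝 0) := by
  classical
  have hΞ : 0 ≤ Ξ := (abs_nonneg _).trans (hξ 0)
  set ν : ℕ → ℕ := fun k => firstHit (fun m => pr (x m)) (T (x k)) k with hν
  have hlim := tendsto_eighthRoot_sq_div.mul_const (κ * Ξ)
  rw [zero_mul] at hlim
  refine squeeze_zero_norm' ?_ hlim
  filter_upwards [eventually_active_subset (T := T) hev] with N hN
  have hswap : ∑ n ∈ Finset.Ioc 0 N, activeWeight pr T q n x * ξ n =
      ∑ k ∈ Finset.Ioc 0 N, q (x k) * ∑ m ∈ (Finset.Ico k (k + ν k)).filter (· ≤ N), ξ m := by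
    have h1 : ∀ n ∈ Finset.Ioc 0 N, activeWeight pr T q n x * ξ n =
        ∑ k ∈ Finset.Ioc 0 N, if k ≤ n ∧ n < k + ν k then q (x k) * ξ n else 0 := by
      intro n hn
      rw [Finset.mem_Ioc] at hn
      rw [activeWeight, Finset.sum_mul]
      have hsub : Finset.Ioc 0 n ⊆ Finset.Ioc 0 N := Finset.Ioc_subset_Ioc_right hn.2
      rw [← Finset.sum_subset hsub fun k hk hk' => if_neg fun h => hk' (Finset.mem_Ioc.2
        ⟨(Finset.mem_Ioc.1 hk).1, h.1⟩)]
      refine Finset.sum_congr rfl fun k hk => ?_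
      have hkn := (Finset.mem_Ioc.1 hk).2
      have := avoid_iff_lt_add_firstHit (z := fun m => pr (x m)) (hne (T (x k)) k) (n := n)
      simp only [this, hkn, true_and, hν, ite_mul, zero_mul]
    rw [Finset.sum_congr rfl h1, Finset.sum_comm]
    refine Finset.sum_congr rfl fun k hk => ?_
    rw [Finset.mul_sum, ← Finset.sum_filter]
    refine Finset.sum_congr ?_ fun _ _ => rfl
    ext n
    simp only [Finset.mem_filter, Finset.mem_Ioc, Finset.mem_Ico] at hk ⊢
    omega
  -- After the exchange of sums, only the portions of the excursions lying beyond time `N` remain.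
  have hdiff : ∑ k ∈ Finset.Ioc 0 N, q (x k) * ∑ m ∈ Finset.Ico k (k + ν k), ξ m -
      ∑ n ∈ Finset.Ioc 0 N, activeWeight pr T q n x * ξ n =
      ∑ k ∈ Finset.Ioc 0 N, q (x k) *
        ∑ m ∈ (Finset.Ico k (k + ν k)).filter (¬ · ≤ N), ξ m := by
    rw [hswap, ← Finset.sum_sub_distrib]
    refine Finset.sum_congr rfl fun k _ => ?_
    rw [← Finset.sum_filter_add_sum_filter_not (Finset.Ico k (k + ν k)) (· ≤ N) ξ]
    ring
  rw [hdiff, Real.norm_eq_abs, abs_mul, abs_of_nonneg (by positivity : (0 : ℝ) ≤ 1 / (N : ℝ)),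
    mul_assoc]
  refine mul_le_mul_of_nonneg_left ?_ (by positivity)
  calc _ ≤ ∑ k ∈ Finset.Ioc 0 N, if k ∈ Finset.Ioc (N - N.eighthRoot) N then
        κ * (N.eighthRoot * Ξ) else 0 := by
        refine (Finset.abs_sum_le_sum_abs _ _).trans (Finset.sum_le_sum fun k hk => ?_)
        by_cases h : N < k + ν k
        · obtain ⟨h1, h2⟩ := hN k hk h
          rw [if_pos h1, abs_mul]
          refine mul_le_mul (hq _) ?_ (abs_nonneg _) hκ
          refine (Finset.abs_sum_le_sum_abs _ _).trans ?_
          refine (Finset.sum_le_sum fun m _ => hξ m).trans ?_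
          rw [Finset.sum_const, nsmul_eq_mul]
          refine mul_le_mul_of_nonneg_right ?_ hΞ
          have h3 := Finset.card_filter_le (Finset.Ico k (k + ν k)) (¬ · ≤ N)
          rw [Nat.card_Ico] at h3
          exact_mod_cast (h3.trans_eq (Nat.add_sub_cancel_left k (ν k))).trans h2
        · rw [Finset.filter_false_of_mem, Finset.sum_empty, mul_zero, abs_zero]
          · split_ifs <;> positivity
          · intro m hm
            have := Finset.mem_Ico.1 hm
            omega
    _ = (Finset.Ioc 0 N ∩ Finset.Ioc (N - N.eighthRoot) N).card * (κ * (N.eighthRoot * Ξ)) := by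
        rw [Finset.sum_ite_mem]
        simp
    _ ≤ N.eighthRoot * (κ * (N.eighthRoot * Ξ)) := by
        refine mul_le_mul_of_nonneg_right (le_trans ?_ (card_Ioc_sub_le N N.eighthRoot))
          (by positivity)
        exact_mod_cast Finset.card_le_card Finset.inter_subset_right
    _ = _ := by ring

/-- The difference `f (z k) - f w` shifts the window of summation from `(k, k + ν]` to `[k, k + ν)`,
where the Poisson equation telescopes with the hit point `w` as endpoint. -/
theorem sum_excursion_eq {P : Matrix E E ℝ} [Fintype E] {h f : E → ℝ} {C : ℝ}
    (hh : ∀ z, h z - (P *ᵥ h) z = f z - C) (hne : {n | 0 < n ∧ z (k + n) = w}.Nonempty) :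
    (f (z k) - f w) + ∑ n ∈ Finset.Ioc k (k + firstHit z w k), f (z n) - firstHit z w k * C =
      (h (z k) - h w) +
        ∑ m ∈ Finset.Ico k (k + firstHit z w k), (h (z (m + 1)) - (P *ᵥ h) (z m)) := by
  have key : ∀ j : ℕ, (f (z k) - f (z (k + j))) + ∑ n ∈ Finset.Ioc k (k + j), f (z n) - j * C =
      (h (z k) - h (z (k + j))) +
        ∑ m ∈ Finset.Ico k (k + j), (h (z (m + 1)) - (P *ᵥ h) (z m)) := by
    intro j
    induction j with
    | zero => simp
    | succ j ih =>
      rw [← add_assoc, Finset.sum_Ioc_succ_top (Nat.le_add_right k j),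
        Finset.sum_Ico_succ_top (Nat.le_add_right k j)]
      have := hh (z (k + j))
      push_cast
      linarith
  have h1 := key (firstHit z w k)
  rwa [(firstHit_mem hne).2] at h1

end FirstHit

/-! ### The law of large numbers for excursions. -/

namespace IsFactorChain

variable {E B Ω : Type*} [Fintype E] [MeasurableSpace B] [MeasurableSpace Ω] [Finite B]
  [DiscreteMeasurableSpace B] {μ : Measure Ω} [IsProbabilityMeasure μ]
  {P : Matrix E E ℝ} {pr : B → E} {X : ℕ → Ω → B}

/-- Almost surely every state is hit after any time, and soon if the time is large. -/
theorem ae_firstHit_le (hX : IsFactorChain μ P pr X) (hP : P.IsIrreducible)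
    (hs : ∀ z, ∑ w, P z w = 1) :
    ∀ᵐ ω ∂μ, (∀ w k, {n | 0 < n ∧ pr (X (k + n) ω) = w}.Nonempty) ∧
      ∀ᶠ k in atTop, ∀ w, firstHit (fun m => pr (X m ω)) w k ≤ k.eighthRoot := by
  have h1 : ∀ w, ∀ᵐ ω ∂μ, ∀ᶠ k : ℕ in atTop,
      ω ∉ {ω | ∀ m ∈ Finset.Ioc k (k + k.eighthRoot), pr (X m ω) ≠ w} := by
    intro w
    obtain ⟨C, ρ, hρ0, hρ1, hC⟩ := hX.exists_measure_avoid_le hP hs w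
    -- Borel–Cantelli, with the geometric tail evaluated at `k^{1/8}`.
    refine ae_eventually_notMem ?_
    refine ne_top_of_le_ne_top
      ((summable_pow_eighthRoot hρ0 hρ1).mul_left C).tsum_ofReal_ne_top
      (ENNReal.tsum_le_tsum fun k => ?_)
    rw [← ofReal_measureReal]
    exact ENNReal.ofReal_le_ofReal (hC k _)
  filter_upwards [ae_all_iff.2 h1] with ω hω
  have h2 : ∀ᶠ k : ℕ in atTop, ∀ w, ∃ m ∈ Finset.Ioc k (k + k.eighthRoot), pr (X m ω) = w := by
    refine eventually_all.2 fun w => (hω w).mono fun k hk => ?_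
    simpa [and_assoc] using hk
  refine ⟨fun w k => ?_, h2.mono fun k hk w => ?_⟩
  · obtain ⟨j, hj, hkj⟩ := (h2.and (eventually_ge_atTop k)).exists
    obtain ⟨m, hm, hmw⟩ := hj w
    have := (Finset.mem_Ioc.1 hm).1
    exact ⟨m - k, by omega, by rwa [Nat.add_sub_cancel' (by omega)]⟩
  · obtain ⟨m, hm, hmw⟩ := hk w
    rw [Finset.mem_Ioc] at hm
    have : firstHit (fun m => pr (X m ω)) w k ≤ m - k :=
      Nat.sInf_le ⟨by omega, by simpa only [Nat.add_sub_cancel' hm.1.le] using hmw⟩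
    omega

/-- The law of large numbers for excursions to random targets. -/
theorem ae_tendsto_average_excursion (hX : IsFactorChain μ P pr X) (hP : P.IsIrreducible)
    (hs : ∀ z, ∑ w, P z w = 1) {h f : E → ℝ} {C : ℝ}
    (hh : ∀ z, h z - (P *ᵥ h) z = f z - C) (T : B → E) (q : B → ℝ) {L : ℝ}
    (hL : ∀ᵐ ω ∂μ, Tendsto (fun N : ℕ => 1 / (N : ℝ) *
      ∑ k ∈ Finset.Ioc 0 N, q (X k ω) * (h (pr (X k ω)) - h (T (X k ω)))) atTop (𝓝 L)) :
    ∀ᵐ ω ∂μ, Tendsto (fun N : ℕ => 1 / (N : ℝ) * ∑ k ∈ Finset.Ioc 0 N, q (X k ω) *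
      ((f (pr (X k ω)) - f (T (X k ω))) +
        ∑ n ∈ Finset.Ioc k (k + firstHit (fun m => pr (X m ω)) (T (X k ω)) k), f (pr (X n ω)) -
        firstHit (fun m => pr (X m ω)) (T (X k ω)) k * C)) atTop (𝓝 L) := by
  obtain ⟨κ, hκ0, hκ⟩ := Finite.exists_abs_le q
  obtain ⟨Ξ, hΞ0, hΞ⟩ := Finite.exists_abs_le fun p : E × E => h p.1 - (P *ᵥ h) p.2
  -- The bound on the active weight holds only eventually and almost surely. Clipping gives a
  -- deterministic bound, as the strong law requires, without losing dependence on the past.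
  set W : ℕ → (ℕ → B) → ℝ := fun n x =>
    max (-(κ * n.eighthRoot)) (min (κ * n.eighthRoot) (activeWeight pr T q n x))
  have hWdep : ∀ n, DependsOn (W n) (Set.Iic n) := fun n x y hxy => by
    simp only [W, dependsOn_activeWeight pr T q n hxy]
  have hWb : ∀ n x, W n x ^ 2 ≤ κ ^ 2 * (n.fourthRoot + 1) := fun n x => by
    have h0 : 0 ≤ κ * (n.eighthRoot : ℝ) := by positivity
    have h1 : |W n x| ≤ |κ * (n.eighthRoot : ℝ)| := by
      rw [abs_of_nonneg h0]
      exact abs_le.2 ⟨le_max_left _ _, max_le (by linarith) (min_le_left _ _)⟩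
    have h2 : (n.eighthRoot : ℝ) ^ 2 ≤ n.fourthRoot := by exact_mod_cast Nat.eighthRoot_sq_le n
    calc W n x ^ 2 ≤ (κ * (n.eighthRoot : ℝ)) ^ 2 := sq_le_sq.2 h1
      _ = κ ^ 2 * (n.eighthRoot : ℝ) ^ 2 := by ring
      _ ≤ _ := by gcongr; linarith
  filter_upwards [hL, hX.ae_firstHit_le hP hs, hX.ae_tendsto_average_transform h hWdep hWb]
    with ω hLω ⟨hne, hev⟩ hW
  have hrem := tendsto_excursion_sub (x := fun m => X m ω) (T := T) hκ0 hκ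
    (ξ := fun m => h (pr (X (m + 1) ω)) - (P *ᵥ h) (pr (X m ω)))
    (fun n => hΞ (pr (X (n + 1) ω), pr (X n ω))) hne hev
  have hW' : Tendsto (fun N : ℕ => 1 / (N : ℝ) * ∑ n ∈ Finset.Ioc 0 N,
      activeWeight pr T q n (fun m => X m ω) *
        (h (pr (X (n + 1) ω)) - (P *ᵥ h) (pr (X n ω)))) atTop (𝓝 0) := by
    obtain ⟨n₀, hn₀⟩ := eventually_atTop.1
      (eventually_abs_activeWeight_le (x := fun m => X m ω) (T := T) hκ0 hκ hne hev)
    have heq : ∀ n ≥ n₀, W n (fun m => X m ω) = activeWeight pr T q n (fun m => X m ω) := by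
      intro n hn
      have := abs_le.1 (hn₀ n hn)
      simp only [W]
      rw [min_eq_right this.2, max_eq_right this.1]
    -- The clip is inactive from `n₀` on, so the error is a fixed finite sum, which `1 / N` removes.
    set D : ℝ := ∑ n ∈ Finset.Ioc 0 n₀, (activeWeight pr T q n (fun m => X m ω) -
      W n (fun m => X m ω)) * (h (pr (X (n + 1) ω)) - (P *ᵥ h) (pr (X n ω)))
    have hD : Tendsto (fun N : ℕ => 1 / (N : ℝ) * D) atTop (𝓝 0) := by
      simpa using (tendsto_one_div_atTop_nhds_zero_nat (𝕜 := ℝ)).mul_const D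
    have hsum := hW.add hD
    rw [add_zero] at hsum
    refine hsum.congr' ?_
    filter_upwards [eventually_ge_atTop n₀] with N hN
    rw [← mul_add]
    congr 1
    have : D = ∑ n ∈ Finset.Ioc 0 N, (activeWeight pr T q n (fun m => X m ω) -
        W n (fun m => X m ω)) * (h (pr (X (n + 1) ω)) - (P *ᵥ h) (pr (X n ω))) := by
      refine Finset.sum_subset (Finset.Ioc_subset_Ioc_right hN) fun n hn hn' => ?_
      rw [heq n (by simp only [Finset.mem_Ioc] at hn hn'; omega), sub_self, zero_mul]
    rw [this, ← Finset.sum_add_distrib]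
    exact Finset.sum_congr rfl fun n _ => by ring
  have htot := (hLω.add hrem).add hW'
  rw [add_zero, add_zero] at htot
  refine htot.congr fun N => ?_
  rw [← mul_add, ← mul_add]
  congr 1
  rw [add_assoc, sub_add_cancel, ← Finset.sum_add_distrib]
  refine Finset.sum_congr rfl fun k _ => ?_
  rw [sum_excursion_eq (z := fun m => pr (X m ω)) hh (hne _ k), mul_add]

end IsFactorChain

/-! ### Average excursion lengths, and chains with independent marks. -/

namespace IsFactorChain

section VisitCount

variable {E B Ω : Type*} [Fintype E] [MeasurableSpace B] [MeasurableSpace Ω] [Finite B]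
  [DiscreteMeasurableSpace B] {μ : Measure Ω} [IsProbabilityMeasure μ]
  {P : Matrix E E ℝ} {pr : B → E} {X : ℕ → Ω → B}

/-- The averages of the lengths of excursions to random targets converge. -/
theorem exists_ae_tendsto_average_firstHit (hX : IsFactorChain μ P pr X) (hP : P.IsIrreducible)
    (hs : ∀ z, ∑ w, P z w = 1)
    (hlln : ∀ g : B → ℝ, ∃ l, ∀ᵐ ω ∂μ, Tendsto (fun N : ℕ => 1 / (N : ℝ) *
      ∑ k ∈ Finset.Ioc 0 N, g (X k ω)) atTop (𝓝 l)) (T : B → E) (q : B → ℝ) :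
    ∃ l, ∀ᵐ ω ∂μ, Tendsto (fun N : ℕ => 1 / (N : ℝ) * ∑ k ∈ Finset.Ioc 0 N, q (X k ω) *
      firstHit (fun m => pr (X m ω)) (T (X k ω)) k) atTop (𝓝 l) := by
  classical
  have : Nonempty E := by
    obtain ⟨ω⟩ := nonempty_of_isProbabilityMeasure μ
    exact ⟨pr (X 0 ω)⟩
  obtain ⟨ϖ, hϖ, hinv⟩ := Matrix.exists_invariant_of_stochastic hP.nonneg hs
  -- Targets are separated because the test function, the indicator of `w`, has to match the target.
  have hw : ∀ w, ∃ l, ∀ᵐ ω ∂μ, Tendsto (fun N : ℕ => 1 / (N : ℝ) * ∑ k ∈ Finset.Ioc 0 N,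
      (if T (X k ω) = w then q (X k ω) else 0) *
        firstHit (fun m => pr (X m ω)) (T (X k ω)) k) atTop (𝓝 l) := by
    intro w
    have hpos := hP.invariant_pos hs hϖ hinv w
    set f : E → ℝ := Pi.single w 1
    obtain ⟨h, hh⟩ := hP.exists_poisson hs hϖ hinv f
    have hC : ∑ v, ϖ v * f v = ϖ w := by simp [f, Pi.single_apply]
    simp_rw [hC] at hh
    obtain ⟨l₁, hl₁⟩ := hlln fun b => (if T b = w then q b else 0) * (h (pr b) - h (T b))
    obtain ⟨l₂, hl₂⟩ := hlln fun b => (if T b = w then q b else 0) * f (pr b)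
    refine ⟨(l₂ - l₁) / ϖ w, ?_⟩
    filter_upwards [hX.ae_tendsto_average_excursion hP hs (f := f) (C := ϖ w) (h := h) hh T
      (fun b => if T b = w then q b else 0) hl₁, hl₂, hX.ae_firstHit_le hP hs]
      with ω h1 h2 ⟨hne, _⟩
    refine ((h2.sub h1).div_const (ϖ w)).congr fun N => ?_
    rw [← mul_sub, mul_div_assoc, ← Finset.sum_sub_distrib, Finset.sum_div]
    congr 1
    refine Finset.sum_congr rfl fun k _ => ?_
    by_cases hT : T (X k ω) = w
    · simp only [hT, if_true]
      set ν := firstHit (fun m => pr (X m ω)) w k with hν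
      obtain ⟨hν0, hνw⟩ := firstHit_mem (z := fun m => pr (X m ω)) (hne w k)
      -- An excursion to `w` visits `w` exactly once, at its end. Its centred sum is thus `f (Z k) -
      -- ν * ϖ w`, which can be solved for `ν` as `ϖ w > 0`.
      have hsum : ∑ n ∈ Finset.Ioc k (k + ν), f (pr (X n ω)) = 1 := by
        rw [Finset.sum_eq_single_of_mem (k + ν)
          (Finset.mem_Ioc.2 ⟨Nat.lt_add_of_pos_right hν0, le_rfl⟩)]
        · simp only [f, hν, hνw, Pi.single_eq_same]
        · intro m hm hmne
          rw [Finset.mem_Ioc] at hm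
          have := (avoid_iff_lt_add_firstHit (z := fun m => pr (X m ω)) (hne w k) (n := m)).2
            (by omega) m (Finset.mem_Ioc.2 ⟨hm.1, le_rfl⟩)
          exact Pi.single_eq_of_ne this 1
      have hfw : f w = 1 := Pi.single_eq_same w 1
      rw [hsum, hfw]
      field_simp
      ring
    · simp [hT]
  choose l hl using hw
  refine ⟨∑ w, l w, ?_⟩
  filter_upwards [ae_all_iff.2 hl] with ω hω
  refine (tendsto_finsetSum Finset.univ fun w _ => hω w).congr fun N => ?_
  rw [← Finset.mul_sum, Finset.sum_comm]
  congr 1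
  refine Finset.sum_congr rfl fun k _ => ?_
  rw [← Finset.sum_mul]
  simp

end VisitCount

section Product

variable {E F Ω : Type*} [MeasurableSpace E] [DiscreteMeasurableSpace E]
  [MeasurableSpace F] [DiscreteMeasurableSpace F] [MeasurableSpace Ω]
  {μ : Measure Ω} {P : Matrix E E ℝ} {Z : ℕ → Ω → E} {Y : ℕ → Ω → F}

/-- Independence of the marks from the whole trajectory factors every event of the joint history, so
revealing marks does not affect the transition probabilities. -/
theorem prodMk (hZ : IsFactorChain μ P id Z) (hY : ∀ n, Measurable (Y n))
    (hYZ : IndepFun (fun ω k => Y k ω) (fun ω n => Z n ω) μ) :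
    IsFactorChain μ P Prod.fst fun n ω => (Z n ω, Y n ω) := by
  refine ⟨fun n => (hZ.1 n).prodMk (hY n), fun n x w => ?_⟩
  set S : Set (ℕ → E) := ⋂ m, ⋂ _ : m ≤ n, (fun z => z m) ⁻¹' {(x m).1}
  set R : Set (ℕ → F) := ⋂ m, ⋂ _ : m ≤ n, (fun y => y m) ⁻¹' {(x m).2}
  have hS : MeasurableSet S := MeasurableSet.iInter fun m => MeasurableSet.iInter fun _ =>
    measurable_pi_apply m .of_discrete
  have hR : MeasurableSet R := MeasurableSet.iInter fun m => MeasurableSet.iInter fun _ =>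
    measurable_pi_apply m .of_discrete
  have hS' : MeasurableSet (S ∩ (fun z => z (n + 1)) ⁻¹' {w}) :=
    hS.inter (measurable_pi_apply (n + 1) .of_discrete)
  have h1 : {ω | (∀ m ≤ n, (Z m ω, Y m ω) = x m) ∧ Z (n + 1) ω = w} =
      (fun ω k => Y k ω) ⁻¹' R ∩ (fun ω n => Z n ω) ⁻¹' (S ∩ (fun z => z (n + 1)) ⁻¹' {w}) := by
    ext ω
    simp only [Set.mem_ofPred_eq, Set.mem_inter_iff, Set.mem_preimage, Set.mem_iInter, S, R,
      Set.mem_singleton_iff, Prod.ext_iff]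
    exact ⟨fun h => ⟨fun m hm => (h.1 m hm).2, fun m hm => (h.1 m hm).1, h.2⟩,
      fun h => ⟨fun m hm => ⟨h.2.1 m hm, h.1 m hm⟩, h.2.2⟩⟩
  have h2 : {ω | ∀ m ≤ n, (Z m ω, Y m ω) = x m} =
      (fun ω k => Y k ω) ⁻¹' R ∩ (fun ω n => Z n ω) ⁻¹' S := by
    ext ω
    simp only [Set.mem_ofPred_eq, Set.mem_inter_iff, Set.mem_preimage, Set.mem_iInter, S, R,
      Set.mem_singleton_iff, Prod.ext_iff]
    exact ⟨fun h => ⟨fun m hm => (h m hm).2, fun m hm => (h m hm).1⟩,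
      fun h m hm => ⟨h.2 m hm, h.1 m hm⟩⟩
  have h3 : (fun ω n => Z n ω) ⁻¹' (S ∩ (fun z => z (n + 1)) ⁻¹' {w}) =
      {ω | (∀ m ≤ n, Z m ω = (x m).1) ∧ id (Z (n + 1) ω) = w} := by
    ext ω; simp [S]
  have h4 : (fun ω n => Z n ω) ⁻¹' S = {ω | ∀ m ≤ n, Z m ω = (x m).1} := by
    ext ω; simp [S]
  have h5 := hZ.2 n (fun m => (x m).1) w
  rw [← h3, ← h4] at h5
  simp only [id] at h5 ⊢
  rw [h1, h2, measureReal_def, measureReal_def,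
    hYZ.measure_inter_preimage_eq_mul _ _ hR hS', hYZ.measure_inter_preimage_eq_mul _ _ hR hS,
    ENNReal.toReal_mul, ENNReal.toReal_mul, ← measureReal_def, ← measureReal_def,
    ← measureReal_def, h5, mul_assoc]

/-- The ergodic theorem for an irreducible chain with independent marks. -/
theorem ae_tendsto_average_prod [Fintype E] [Fintype F] [IsProbabilityMeasure μ]
    (hZ : IsFactorChain μ P id Z) (hP : P.IsIrreducible)
    (hs : ∀ z, ∑ w, P z w = 1) {ϖ : E → ℝ} (hϖ : ϖ ∈ stdSimplex ℝ E) (hinv : ϖ ᵥ* P = ϖ)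
    (hY : ∀ n, Measurable (Y n)) {φ : F → ℝ} (hφ : ∀ k a, μ.real {ω | Y k ω = a} = φ a)
    (hYi : iIndepFun Y μ) (hYZ : IndepFun (fun ω k => Y k ω) (fun ω n => Z n ω) μ)
    (g : E × F → ℝ) :
    ∀ᵐ ω ∂μ, Tendsto (fun N : ℕ => 1 / (N : ℝ) * ∑ k ∈ Finset.Ioc 0 N, g (Z k ω, Y k ω))
      atTop (𝓝 (∑ z, ϖ z * ∑ a, φ a * g (z, a))) := by
  classical
  set u : E → E → ℝ := fun z z' => if z' = z then 1 else 0
  -- Centring the mark indicator makes the products with `u` orthogonal at different times: the two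
  -- centred marks are independent of each other and of the chain.
  set v : F → F → ℝ := fun a a' => (if a' = a then 1 else 0) - φ a
  have hmu : ∀ z, Measurable (u z) := fun z => .of_discrete
  have hmv : ∀ a, Measurable (v a) := fun a => .of_discrete
  have hv0 : ∀ a k, ∫ ω, v a (Y k ω) ∂μ = 0 := by
    intro a k
    have hmeas : MeasurableSet {ω | Y k ω = a} := hY k (.of_discrete (s := {a}))
    have hi : (fun ω => if Y k ω = a then (1 : ℝ) else 0) = {ω | Y k ω = a}.indicator 1 := by
      ext ω; simp [Set.indicator_apply]
    simp only [v]
    rw [integral_sub (by rw [hi]; exact (integrable_const _).indicator hmeas)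
      (integrable_const _), hi, integral_indicator_one hmeas, hφ]
    simp
  have hone : ∀ z a, ∀ᵐ ω ∂μ, Tendsto (fun N : ℕ => 1 / (N : ℝ) *
      ∑ k ∈ Finset.Ioc 0 N, u z (Z k ω) * v a (Y k ω)) atTop (𝓝 0) := by
    intro z a
    obtain ⟨K, hK0, hK⟩ := Finite.exists_abs_le fun p : E × F => u z p.1 * v a p.2
    refine ae_tendsto_average_of_orthogonal (C := K ^ 2) (fun n => ?_) (fun n ω => ?_)
      fun j k hjk => ?_
    · exact ((hmu z).comp (hZ.1 n)).mul ((hmv a).comp (hY n))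
    · calc (u z (Z n ω) * v a (Y n ω)) ^ 2 ≤ K ^ 2 :=
            sq_le_sq.2 ((hK (Z n ω, Y n ω)).trans (le_abs_self K))
        _ ≤ K ^ 2 * (n.fourthRoot + 1) :=
            le_mul_of_one_le_right (sq_nonneg K) (by simp)
    · have hm1 : Measurable fun y : ℕ → F => v a (y j) * v a (y k) :=
        ((hmv a).comp (measurable_pi_apply j)).mul ((hmv a).comp (measurable_pi_apply k))
      have hm2 : Measurable fun z' : ℕ → E => u z (z' j) * u z (z' k) :=
        ((hmu z).comp (measurable_pi_apply j)).mul ((hmu z).comp (measurable_pi_apply k))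
      have h1 := (hYZ.comp hm1 hm2).integral_fun_mul_eq_mul_integral
        (hm1.comp (measurable_pi_lambda _ hY)).aestronglyMeasurable
        (hm2.comp (measurable_pi_lambda _ hZ.1)).aestronglyMeasurable
      have h2 := ((hYi.indepFun hjk.ne).comp (hmv a) (hmv a)).integral_fun_mul_eq_mul_integral
        ((hmv a).comp (hY j)).aestronglyMeasurable ((hmv a).comp (hY k)).aestronglyMeasurable
      simp only [Function.comp] at h1 h2
      rw [hv0, zero_mul] at h2
      rw [h2, zero_mul] at h1
      rw [← h1]
      exact integral_congr_ae (ae_of_all _ fun ω => by ring)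
  filter_upwards [ae_all_iff.2 fun z => ae_all_iff.2 (hone z),
    hZ.ae_tendsto_average hP hs hϖ hinv fun z => ∑ a, φ a * g (z, a)] with ω h1 h2
  have h3 := tendsto_finsetSum Finset.univ fun z _ =>
    tendsto_finsetSum Finset.univ fun a _ => (h1 z a).const_mul (g (z, a))
  have h4 := h2.add h3
  simp only [mul_zero, Finset.sum_const_zero, add_zero] at h4
  refine h4.congr fun N => ?_
  -- `g` is its average over the mark plus a finite combination of the orthogonal variables; the
  -- average is a function of the chain alone.
  have key : ∀ k, ∑ a, φ a * g (Z k ω, a) +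
      ∑ z, ∑ a, g (z, a) * (u z (Z k ω) * v a (Y k ω)) = g (Z k ω, Y k ω) := by
    intro k
    have : ∀ z, ∑ a, g (z, a) * (u z (Z k ω) * v a (Y k ω)) =
        if Z k ω = z then g (z, Y k ω) - ∑ a, φ a * g (z, a) else 0 := by
      intro z
      by_cases hz : Z k ω = z
      · simp only [u, v, hz, if_true, one_mul]
        simp_rw [mul_sub, Finset.sum_sub_distrib]
        simp [mul_comm]
      · simp [u, hz]
    simp_rw [this]
    simp
  simp_rw [← key, Finset.sum_add_distrib, mul_add]
  congr 1
  symm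
  rw [Finset.sum_comm, Finset.mul_sum]
  refine Finset.sum_congr rfl fun z _ => ?_
  rw [Finset.sum_comm, Finset.mul_sum]
  refine Finset.sum_congr rfl fun a _ => ?_
  rw [← Finset.mul_sum]
  ring

end Product

end IsFactorChain

/-! ### The spherical policy and its derivatives. -/

namespace MDP

section PolicyLemmas

variable {S : Type*} {d : S → ℕ}

theorem mem_interior_angleBox [Finite S] {α : Angles d} :
    α ∈ interior (angleBox d) ↔ ∀ i p, α i p ∈ Set.Ioo 0 (Real.pi / 2) := by
  have : angleBox d = Set.univ.pi fun i => Set.univ.pi fun _ : Fin (d i) =>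
      Set.Icc 0 (Real.pi / 2) := by
    ext β; simp only [angleBox, Set.mem_pi, Set.mem_univ, true_imp_iff]; rfl
  rw [this, interior_pi_set Set.finite_univ]
  simp only [interior_pi_set Set.finite_univ, interior_Icc, Set.mem_pi, Set.mem_univ,
    true_imp_iff]

/-- The product of the first `n` factors `sin² α_{ik}`. -/
noncomputable def sinSqProd (α : Angles d) (i : S) (n : ℕ) : ℝ :=
  ∏ k ∈ Finset.univ.filter (fun k : Fin (d i) => (k : ℕ) < n), Real.sin (α i k) ^ 2

theorem sinSqProd_succ (α : Angles d) (i : S) (p : Fin (d i)) :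
    sinSqProd α i (p + 1) = Real.sin (α i p) ^ 2 * sinSqProd α i p := by
  have : Finset.univ.filter (fun k : Fin (d i) => (k : ℕ) < p + 1) =
      insert p (Finset.univ.filter fun k : Fin (d i) => (k : ℕ) < p) := by
    ext k
    simp only [Finset.mem_filter, Finset.mem_univ, true_and, Finset.mem_insert, Fin.ext_iff]
    omega
  rw [sinSqProd, this, Finset.prod_insert (by simp), sinSqProd]

theorem prod_Iic_sin_sq (α : Angles d) (i : S) (p : Fin (d i)) :
    ∏ m ∈ Finset.Iic p, Real.sin (α i m) ^ 2 = sinSqProd α i (p + 1) := by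
  refine Finset.prod_congr ?_ fun _ _ => rfl
  ext k
  simp only [Finset.mem_Iic, Finset.mem_filter, Finset.mem_univ, true_and, Fin.le_def]
  omega

theorem policy_castSucc (α : Angles d) (i : S) (p : Fin (d i)) :
    policy α i p.castSucc = Real.cos (α i p) ^ 2 * sinSqProd α i p := by
  simp [policy, sphericalCoord, mul_pow, sinSqProd, Finset.prod_pow]

theorem policy_last (α : Angles d) (i : S) :
    policy α i (Fin.last (d i)) = sinSqProd α i (d i) := by
  simp [policy, sphericalCoord, sinSqProd, Finset.prod_pow]

theorem sum_policy (α : Angles d) (i : S) : ∑ a, policy α i a = 1 := by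
  -- Stick breaking: as `cos² = 1 - sin²`, each probability is a difference of consecutive products,
  -- and the sum telescopes.
  have h : ∀ p : Fin (d i), policy α i p.castSucc =
      sinSqProd α i p - sinSqProd α i (p + 1) := fun p => by
    rw [policy_castSucc, sinSqProd_succ, Real.cos_sq']; ring
  rw [Fin.sum_univ_castSucc, policy_last]
  simp_rw [h]
  rw [Fin.sum_univ_eq_sum_range (fun n => sinSqProd α i n - sinSqProd α i (n + 1)),
    Finset.sum_range_sub']
  simp [sinSqProd]

theorem sinSqProd_pos [Finite S] {α : Angles d} (hα : α ∈ interior (angleBox d)) (i : S) (n : ℕ) :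
    0 < sinSqProd α i n :=
  Finset.prod_pos fun k _ => pow_pos (Real.sin_pos_of_mem_Ioo
    ⟨(mem_interior_angleBox.1 hα i k).1,
      (mem_interior_angleBox.1 hα i k).2.trans (by linarith [Real.pi_pos])⟩) 2

theorem differentiable_policy [Fintype S] (i : S) (a : Fin (d i + 1)) :
    Differentiable ℝ fun α : Angles d => policy α i a := by
  have h1 : ∀ k, Differentiable ℝ fun α : Angles d => α i k := fun k => by fun_prop
  classical
  unfold policy sphericalCoord
  refine Differentiable.pow (Differentiable.mul ?_ ?_) 2
  · split_ifs
    · exact (h1 _).cos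
    · fun_prop
  · exact fun α => (HasFDerivAt.finsetProd fun k _ => ((h1 k).sin α).hasFDerivAt).differentiableAt

/-- The policy `θ_{ia}` differentiated with respect to the angle `α_{ip}`. -/
noncomputable def policyDeriv (α : Angles d) (i : S) (p : Fin (d i)) (a : Fin (d i + 1)) : ℝ :=
  if (a : ℕ) < p then 0
  else if (a : ℕ) = p then -2 * Real.tan (α i p) * policy α i a
  else 2 * (Real.cos (α i p) / Real.sin (α i p)) * policy α i a

variable [DecidableEq S]

/-- The curve through `α` in the direction of the coordinate `α_{ip}`. -/
def angleCurve (α : Angles d) (i : S) (p : Fin (d i)) (t : ℝ) : Angles d :=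
  Function.update α i (Function.update (α i) p t)

theorem angleCurve_self (α : Angles d) (i : S) (p : Fin (d i)) :
    angleCurve α i p (α i p) = α := by
  simp [angleCurve]

theorem hasDerivAt_angleCurve [Fintype S] (α : Angles d) (i : S) (p : Fin (d i)) (t : ℝ) :
    HasDerivAt (angleCurve α i p) (Pi.single i (Pi.single p 1)) t := by
  refine hasDerivAt_pi.2 fun j => ?_
  by_cases hj : j = i
  · subst hj
    simpa [angleCurve] using hasDerivAt_update (α j) p t
  · simpa [angleCurve, hj] using hasDerivAt_const t (α j)

theorem policy_angleCurve_of_ne (α : Angles d) {i j : S} (hj : j ≠ i) (p : Fin (d i)) (t : ℝ)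
    (a : Fin (d j + 1)) : policy (angleCurve α i p t) j a = policy α j a := by
  simp [policy, sphericalCoord, angleCurve, hj]

/-- With angles numbered from `0`, the angle `p` does not occur in `θ_{ia}` for `a < p`, occurs as
`cos²` for `a = p` and as `sin²` for `a > p`; the logarithmic derivatives are `-2 tan` and `2 cot`.
-/
theorem hasDerivAt_policy_angleCurve [Finite S] {α : Angles d} (hα : α ∈ interior (angleBox d))
    (i : S) (p : Fin (d i)) (a : Fin (d i + 1)) :
    HasDerivAt (fun t => policy (angleCurve α i p t) i a) (policyDeriv α i p a) (α i p) := by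
  have hs : Real.sin (α i p) ≠ 0 := (Real.sin_pos_of_mem_Ioo
    ⟨(mem_interior_angleBox.1 hα i p).1,
      (mem_interior_angleBox.1 hα i p).2.trans (by linarith [Real.pi_pos])⟩).ne'
  have hc : Real.cos (α i p) ≠ 0 := (Real.cos_pos_of_mem_Ioo
    ⟨by linarith [Real.pi_pos, (mem_interior_angleBox.1 hα i p).1],
      (mem_interior_angleBox.1 hα i p).2⟩).ne'
  have hcurve : ∀ t k, angleCurve α i p t i k = if k = p then t else α i k := fun t k => by
    simp [angleCurve, Function.update_apply]
  have hprod : ∀ t (n : ℕ), n ≤ p →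
      ∏ k ∈ Finset.univ.filter (fun k : Fin (d i) => (k : ℕ) < n),
        Real.sin (angleCurve α i p t i k) =
      ∏ k ∈ Finset.univ.filter (fun k : Fin (d i) => (k : ℕ) < n), Real.sin (α i k) := by
    intro t n hn
    refine Finset.prod_congr rfl fun k hk => ?_
    rw [hcurve, if_neg]
    rintro rfl
    simp at hk
    omega
  unfold policyDeriv
  split_ifs with h1 h2
  · have : (fun t => policy (angleCurve α i p t) i a) = fun _ => policy α i a := by
      ext t
      have had : (a : ℕ) < d i := h1.trans p.2
      simp only [policy, sphericalCoord, dif_pos had]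
      rw [hprod t a h1.le, hcurve, if_neg]
      rintro h
      have := congrArg Fin.val h
      simp at this
      omega
    rw [this]
    exact hasDerivAt_const _ _
  · have hap : a = p.castSucc := Fin.ext h2
    subst hap
    have hq : ∀ t, sinSqProd (angleCurve α i p t) i p = sinSqProd α i p := fun t => by
      simp only [sinSqProd, Finset.prod_pow]
      rw [hprod t p le_rfl]
    have : (fun t => policy (angleCurve α i p t) i p.castSucc) =
        fun t => Real.cos t ^ 2 * sinSqProd α i p := by
      ext t
      rw [policy_castSucc, hq, hcurve, if_pos rfl]
    rw [this]
    refine (((Real.hasDerivAt_cos (α i p)).pow 2).mul_const (sinSqProd α i p)).congr_deriv ?_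
    rw [policy_castSucc, Real.tan_eq_sin_div_cos]
    field_simp
    simp
    ring
  · have hpa : (p : ℕ) < a := by omega
    have : (fun t => policy (angleCurve α i p t) i a) =
        fun t => Real.sin t ^ 2 * (policy α i a / Real.sin (α i p) ^ 2) := by
      ext t
      have hp : p ∈ Finset.univ.filter (fun k : Fin (d i) => (k : ℕ) < a) := by simpa using hpa
      have h3 : ∀ t, sphericalCoord (angleCurve α i p t) i a =
          Real.sin t * ((if h : (a : ℕ) < d i then Real.cos (α i ⟨a, h⟩) else 1) *
            ∏ k ∈ (Finset.univ.filter fun k : Fin (d i) => (k : ℕ) < a).erase p,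
              Real.sin (α i k)) := by
        intro t
        have h4 : ∏ k ∈ (Finset.univ.filter fun k : Fin (d i) => (k : ℕ) < a).erase p,
              Real.sin (angleCurve α i p t i k) =
            ∏ k ∈ (Finset.univ.filter fun k : Fin (d i) => (k : ℕ) < a).erase p,
              Real.sin (α i k) :=
          Finset.prod_congr rfl fun k hk => by rw [hcurve, if_neg (Finset.ne_of_mem_erase hk)]
        have h5 : (if h : (a : ℕ) < d i then Real.cos (angleCurve α i p t i ⟨a, h⟩) else 1) =
            if h : (a : ℕ) < d i then Real.cos (α i ⟨a, h⟩) else 1 := by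
          split_ifs with h
          · rw [hcurve, if_neg]
            intro h
            have := congrArg Fin.val h
            simp at this
            omega
          · rfl
        rw [sphericalCoord, ← Finset.mul_prod_erase _ _ hp, h4, h5, hcurve, if_pos rfl]
        ring
      have h6 := h3 (α i p)
      rw [angleCurve_self] at h6
      rw [policy, policy, h3 t, h6]
      field_simp
    rw [this]
    refine (((Real.hasDerivAt_sin (α i p)).pow 2).mul_const
      (policy α i a / Real.sin (α i p) ^ 2)).congr_deriv ?_
    field_simp
    simp
    ring

end PolicyLemmas

/-! ### Differentiating the stationary distribution and cost. -/

section Stationary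

variable {S : Type*} [Fintype S] {d : S → ℕ}

theorem kernel_sum (M : MDP S d) (α : Angles d) (z : StateAction d) :
    ∑ w, M.kernel α z w = 1 := by
  rw [Fintype.sum_sigma]
  simp_rw [kernel, ← Finset.sum_mul, sum_policy, one_mul, M.A_sum]

variable {M : MDP S d} {α : Angles d}

theorem existsUnique_isInvariant [Nonempty (StateAction d)] (hM : (M.kernel α).IsIrreducible) :
    ∃! ϖ, M.IsInvariant α ϖ := by
  classical
  obtain ⟨ϖ, hϖ, hinv⟩ := Matrix.exists_invariant_of_stochastic hM.nonneg (M.kernel_sum α)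
  refine ⟨ϖ, ⟨hϖ, hinv⟩, fun ϖ' h' => ?_⟩
  rw [hM.eq_vecMul_inv_fundamental (M.kernel_sum α) hϖ hinv,
    hM.eq_vecMul_inv_fundamental (M.kernel_sum α) h'.1 h'.2]

theorem isInvariant_statDist [Nonempty (StateAction d)] (hM : (M.kernel α).IsIrreducible) :
    M.IsInvariant α (M.statDist α) :=
  Classical.epsilon_spec (existsUnique_isInvariant hM).exists

theorem _root_.Differentiable.matrix_det {n V : Type*} [Fintype n] [DecidableEq n]
    [NormedAddCommGroup V] [NormedSpace ℝ V] {B : V → Matrix n n ℝ}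
    (hB : ∀ i j, Differentiable ℝ fun v => B v i j) : Differentiable ℝ fun v => (B v).det := by
  simp_rw [Matrix.det_apply]
  exact Differentiable.fun_sum fun σ _ => Differentiable.const_smul (fun v =>
    (HasFDerivAt.finsetProd fun i _ => (hB (σ i) i v).hasFDerivAt).differentiableAt) _

theorem _root_.DifferentiableAt.matrix_inv {n V : Type*} [Fintype n] [DecidableEq n]
    [NormedAddCommGroup V] [NormedSpace ℝ V] {B : V → Matrix n n ℝ} {v : V}
    (hB : ∀ i j, Differentiable ℝ fun v => B v i j) (hv : (B v).det ≠ 0) (i j : n) :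
    DifferentiableAt ℝ (fun v => (B v)⁻¹ i j) v := by
  simp_rw [Matrix.inv_def, Ring.inverse_eq_inv', Matrix.smul_apply, Matrix.adjugate_apply,
    smul_eq_mul]
  refine ((Differentiable.matrix_det hB v).inv hv).mul (Differentiable.matrix_det ?_ v)
  intro k l
  by_cases hk : k = j
  · subst hk
    simp only [Matrix.updateRow_self]
    exact differentiable_const _
  · simp only [Matrix.updateRow_ne hk]
    exact hB k l

theorem differentiable_kernel (M : MDP S d) (z w : StateAction d) :
    Differentiable ℝ fun α => M.kernel α z w :=
  (differentiable_policy w.1 w.2).mul_const _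

/-- Near `α` the invariant vector is given by the column sums of the inverse fundamental matrix,
whose entries are differentiable. Irreducibility is needed on a whole neighbourhood for this formula
to hold. -/
theorem differentiableAt_statDist [Nonempty (StateAction d)] (hM : M.IsErgodic)
    (hα : α ∈ interior (angleBox d)) (z : StateAction d) :
    DifferentiableAt ℝ (fun β => M.statDist β z) α := by
  classical
  have heq : (fun β => M.statDist β z) =ᶠ[𝓝 α]
      fun β => ∑ w, (M.kernel β).fundamental⁻¹ w z := by
    filter_upwards [isOpen_interior.mem_nhds hα] with β hβ
    have h := isInvariant_statDist (hM β hβ)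
    rw [(hM β hβ).eq_vecMul_inv_fundamental (M.kernel_sum β) h.1 h.2]
    simp [Matrix.vecMul, dotProduct]
  refine DifferentiableAt.congr_of_eventuallyEq ?_ heq
  refine DifferentiableAt.fun_sum fun w _ => DifferentiableAt.matrix_inv
    (B := fun β => (M.kernel β).fundamental) (fun u v => ?_)
    ((hM α hα).det_fundamental_ne_zero (M.kernel_sum α)) w z
  simp only [Matrix.fundamental, Matrix.add_apply, Matrix.sub_apply, Matrix.of_apply]
  exact ((differentiable_const _).sub (differentiable_kernel M u v)).add_const _

theorem differentiableAt_statCost [Nonempty (StateAction d)] (hM : M.IsErgodic)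
    (hα : α ∈ interior (angleBox d)) (c : StateAction d → ℝ) :
    DifferentiableAt ℝ (M.statCost c) α :=
  DifferentiableAt.fun_sum fun z _ => (differentiableAt_statDist hM hα z).mul_const (c z)

/-- The stationary probability of arriving at state `i`. -/
noncomputable def stateMass (M : MDP S d) (α : Angles d) (i : S) : ℝ :=
  ∑ z : StateAction d, M.statDist α z * M.A z.1 z.2 i

/-- The action is drawn from the policy of the state reached, independently of the previous pair, so
the stationary law factors. -/
theorem statDist_eq [Nonempty (StateAction d)] (hM : (M.kernel α).IsIrreducible)
    (i : S) (a : Fin (d i + 1)) :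
    M.statDist α ⟨i, a⟩ = M.stateMass α i * policy α i a := by
  have h := congrFun (isInvariant_statDist hM).2 ⟨i, a⟩
  rw [← h, stateMass, Finset.sum_mul]
  simp only [Matrix.vecMul, dotProduct, kernel]
  exact Finset.sum_congr rfl fun z _ => by ring

/-- The derivative of the stationary cost in terms of a solution of the Poisson equation. -/
theorem fderiv_statCost_single [DecidableEq S] [Nonempty (StateAction d)] (hM : M.IsErgodic)
    (hα : α ∈ interior (angleBox d)) (c : StateAction d → ℝ) {h : StateAction d → ℝ}
    (hh : ∀ z, h z - (M.kernel α *ᵥ h) z = c z - M.statCost c α) (i : S) (p : Fin (d i)) :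
    fderiv ℝ (M.statCost c) α (Pi.single i (Pi.single p 1)) =
      M.stateMass α i * ∑ a, policyDeriv α i p a * h ⟨i, a⟩ := by
  set γ := angleCurve α i p with hγ
  have hγ0 : γ (α i p) = α := angleCurve_self α i p
  have hγ' := hasDerivAt_angleCurve α i p (α i p)
  have hC : HasDerivAt (fun t => M.statCost c (γ t))
      (fderiv ℝ (M.statCost c) α (Pi.single i (Pi.single p 1))) (α i p) := by
    have h1 := (differentiableAt_statCost hM hα c).hasFDerivAt
    rw [← hγ0] at h1
    have h2 := h1.comp_hasDerivAt (α i p) hγ'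
    rwa [hγ0] at h2
  have hev : ∀ᶠ t in 𝓝 (α i p), γ t ∈ interior (angleBox d) := by
    refine hγ'.continuousAt.eventually ?_
    rw [← hγ, hγ0]
    exact isOpen_interior.mem_nhds hα
  have hpt : ∀ z, HasDerivAt (fun t => M.statDist (γ t) z)
      (fderiv ℝ (fun β => M.statDist β z) α (Pi.single i (Pi.single p 1))) (α i p) := by
    intro z
    have h1 := (differentiableAt_statDist hM hα z).hasFDerivAt
    rw [← hγ0] at h1
    have h2 := h1.comp_hasDerivAt (α i p) hγ'
    rwa [hγ0] at h2
  -- The exact perturbation formula `C(γ t) - C(α) = π(γ t) (P(γ t) - P(α)) h`; only state `i`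
  -- contributes, since the curve moves only its policy.
  have hdiff : (fun t => M.statCost c (γ t)) =ᶠ[𝓝 (α i p)] fun t => M.statCost c α +
      ∑ z : StateAction d, M.statDist (γ t) z *
        (M.A z.1 z.2 i * ∑ a, (policy (γ t) i a - policy α i a) * h ⟨i, a⟩) := by
    filter_upwards [hev] with t ht
    have hinv := isInvariant_statDist (hM _ ht)
    have hstep : ∀ z, M.A z.1 z.2 i * ∑ a, (policy (γ t) i a - policy α i a) * h ⟨i, a⟩ =
        (M.kernel (γ t) *ᵥ h) z - (M.kernel α *ᵥ h) z := by
      intro z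
      simp only [Matrix.mulVec, dotProduct, kernel]
      rw [← Finset.sum_sub_distrib, Fintype.sum_sigma, Finset.sum_eq_single i, Finset.mul_sum]
      · exact Finset.sum_congr rfl fun a _ => by ring
      · intro j _ hj
        refine Finset.sum_eq_zero fun a _ => ?_
        rw [hγ, policy_angleCurve_of_ne α hj, sub_self]
      · simp
    have hsum : ∑ z, M.statDist (γ t) z * (M.kernel (γ t) *ᵥ h) z =
        ∑ z, M.statDist (γ t) z * h z := by
      have := Matrix.dotProduct_mulVec (M.statDist (γ t)) (M.kernel (γ t)) h
      rw [hinv.2] at this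
      exact this
    have hP : ∀ z, (M.kernel α *ᵥ h) z = h z - c z + M.statCost c α := fun z => by
      linarith [hh z]
    simp_rw [hstep, mul_sub, Finset.sum_sub_distrib, hsum, hP, mul_add, mul_sub,
      Finset.sum_add_distrib, Finset.sum_sub_distrib, ← Finset.sum_mul, hinv.1.2]
    rw [statCost]
    ring
  refine hC.unique (HasDerivAt.congr_of_eventuallyEq ?_ hdiff)
  have hsum : HasDerivAt (fun t => ∑ z : StateAction d, M.statDist (γ t) z *
        (M.A z.1 z.2 i * ∑ a, (policy (γ t) i a - policy α i a) * h ⟨i, a⟩))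
      (∑ z : StateAction d, (fderiv ℝ (fun β => M.statDist β z) α (Pi.single i (Pi.single p 1)) *
        (M.A z.1 z.2 i * ∑ a, (policy (γ (α i p)) i a - policy α i a) * h ⟨i, a⟩) +
        M.statDist (γ (α i p)) z * (M.A z.1 z.2 i * ∑ a, policyDeriv α i p a * h ⟨i, a⟩)))
      (α i p) :=
    HasDerivAt.fun_sum fun z _ => (hpt z).mul ((HasDerivAt.fun_sum fun a _ =>
      ((hasDerivAt_policy_angleCurve hα i p a).sub_const _).mul_const _).const_mul _)
  convert hsum.const_add (M.statCost c α) using 1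
  -- The derivative of the stationary distribution is multiplied by `P(γ t) - P(α)`, which vanishes
  -- at the base point.
  simp only [hγ0, sub_self, zero_mul, Finset.sum_const_zero, mul_zero, zero_add]
  rw [stateMass, Finset.sum_mul]
  exact Finset.sum_congr rfl fun z _ => by ring

end Stationary

end MDP

/-! ### From the gradient to the phantom weights. -/

namespace MDP

section Estimator

variable {S : Type*} [Fintype S] {d : S → ℕ} {M : MDP S d} {α : Angles d}

instance : DiscreteMeasurableSpace (StateAction d) :=
  ⟨fun s => MeasurableSpace.measurableSet_iInf.2 fun i =>
    (MeasurableSet.of_discrete : MeasurableSet (Sigma.mk i ⁻¹' s))⟩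

variable {Ω : Type*} [MeasurableSpace Ω] {μ : Measure Ω} {Z : ℕ → Ω → StateAction d}

theorem IsTrajectory.isFactorChain (hZ : M.IsTrajectory α μ Z) :
    IsFactorChain μ (M.kernel α) id Z := by
  classical
  refine ⟨hZ.1, fun n x w => ?_⟩
  have h := hZ.2 n (Function.update x (n + 1) w)
  have hne : ∀ m ≤ n, Function.update x (n + 1) w m = x m := fun m hm =>
    Function.update_of_ne (by omega) _ _
  have h1 : {ω | ∀ m ≤ n, Z m ω = Function.update x (n + 1) w m} =
      {ω | ∀ m ≤ n, Z m ω = x m} := by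
    ext ω
    exact forall₂_congr fun m hm => by rw [hne m hm]
  have h2 : {ω | ∀ m ≤ n + 1, Z m ω = Function.update x (n + 1) w m} =
      {ω | (∀ m ≤ n, Z m ω = x m) ∧ id (Z (n + 1) ω) = w} := by
    ext ω
    constructor
    · exact fun h => ⟨fun m hm => (h m (Nat.le_succ_of_le hm)).trans (hne m hm),
        (h (n + 1) le_rfl).trans (Function.update_self _ _ _)⟩
    · rintro ⟨ha, hb⟩ m hm
      rcases Nat.le_succ_iff.1 hm with hm | rfl
      · rw [hne m hm, ha m hm]
      · rw [Function.update_self]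
        exact hb
  rw [h1, h2, Function.update_self, hne n le_rfl] at h
  exact h

/-- The weak derivative: the rate at which mass leaves action `p` is redistributed over the higher
actions by the phantom law. For `a > p`, dividing `2 sin cos ∏_{k<p} sin²` by the normaliser
`∏_{k≤p} sin²` yields `2 cot`. -/
theorem policyDeriv_eq (hα : α ∈ interior (angleBox d)) (i : S) (p : Fin (d i))
    (a : Fin (d i + 1)) :
    policyDeriv α i p a = -2 * Real.tan (α i p) * policy α i p.castSucc *
      ((if a = p.castSucc then 1 else 0) - phantomLaw α i p a) := by
  have hs : Real.sin (α i p) ≠ 0 := (Real.sin_pos_of_mem_Ioo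
    ⟨(mem_interior_angleBox.1 hα i p).1,
      (mem_interior_angleBox.1 hα i p).2.trans (by linarith [Real.pi_pos])⟩).ne'
  have hc : Real.cos (α i p) ≠ 0 := (Real.cos_pos_of_mem_Ioo
    ⟨by linarith [Real.pi_pos, (mem_interior_angleBox.1 hα i p).1],
      (mem_interior_angleBox.1 hα i p).2⟩).ne'
  have hS := (sinSqProd_pos hα i p).ne'
  have hle : p.succ ≤ a ↔ (p : ℕ) < a := by
    rw [Fin.le_def, Fin.val_succ]; rfl
  have heq : a = p.castSucc ↔ (a : ℕ) = p := by
    rw [Fin.ext_iff, Fin.val_castSucc]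
  unfold policyDeriv phantomLaw
  simp only [hle, heq]
  split_ifs with h1 h2 h3 h3 h3
  · omega
  · omega
  · omega
  · simp
  · omega
  · rw [heq.2 (by assumption)]
    ring
  · rw [prod_Iic_sin_sq, sinSqProd_succ, policy_castSucc, Real.tan_eq_sin_div_cos]
    field_simp
    ring
  · omega

variable [DecidableEq S]

/-- Below the last angle this is the weak derivative with `θ_{ip}` absorbed in the stationary mass.
At the last angle the phantom law is a point mass, and the swap uses visits to both final actions:
their contributions carry `cos²` and `sin²` with the same difference of `h`, and add up to the full
term. -/
theorem sum_weight_eq_deriv [Nonempty (StateAction d)] (hM : (M.kernel α).IsIrreducible)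
    (hα : α ∈ interior (angleBox d)) (i : S) (p : Fin (d i))
    (hφ : ∑ a, phantomLaw α i p a = 1) (h : StateAction d → ℝ) :
    2 * ∑ z, M.statDist α z * ∑ a, phantomLaw α i p a *
      (weight α i p z * (h z - h ⟨i, phantomAction i p z a⟩)) =
      M.stateMass α i * ∑ a, policyDeriv α i p a * h ⟨i, a⟩ := by
  have hc : Real.cos (α i p) ≠ 0 := (Real.cos_pos_of_mem_Ioo
    ⟨by linarith [Real.pi_pos, (mem_interior_angleBox.1 hα i p).1],
      (mem_interior_angleBox.1 hα i p).2⟩).ne'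
  have hR : M.stateMass α i * ∑ a, policyDeriv α i p a * h ⟨i, a⟩ =
      -2 * Real.tan (α i p) * M.statDist α ⟨i, p.castSucc⟩ *
        (h ⟨i, p.castSucc⟩ - ∑ a, phantomLaw α i p a * h ⟨i, a⟩) := by
    simp_rw [policyDeriv_eq hα, mul_assoc, sub_mul, ← Finset.mul_sum, Finset.sum_sub_distrib]
    rw [statDist_eq hM]
    simp
    ring
  have hvisit : ∀ (a : Fin (d i + 1)) (F : StateAction d → ℝ),
      ∑ z, visit i a z * F z = F ⟨i, a⟩ := fun a F => by simp [visit]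
  rw [hR]
  by_cases hp : (p : ℕ) + 1 < d i
  · have h1 : ∀ z, M.statDist α z * ∑ a, phantomLaw α i p a *
        (weight α i p z * (h z - h ⟨i, phantomAction i p z a⟩)) =
        visit i p.castSucc z * (-Real.tan (α i p) * M.statDist α z *
          (h z - ∑ a, phantomLaw α i p a * h ⟨i, a⟩)) := by
      intro z
      have : h z - ∑ a, phantomLaw α i p a * h ⟨i, a⟩ =
          ∑ a, phantomLaw α i p a * (h z - h ⟨i, a⟩) := by
        simp_rw [mul_sub, Finset.sum_sub_distrib, ← Finset.sum_mul, hφ, one_mul]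
      rw [this, Finset.mul_sum, Finset.mul_sum, Finset.mul_sum]
      refine Finset.sum_congr rfl fun a _ => ?_
      simp only [weight, phantomAction, if_pos hp]
      ring
    simp_rw [h1]
    rw [hvisit]
    ring
  · have hφ0 : ∀ a, a ≠ p.succ → phantomLaw α i p a = 0 := by
      intro a ha
      rw [phantomLaw, if_neg]
      intro hle
      apply ha
      have h1 := Fin.le_def.1 hle
      have h2 := a.2
      rw [Fin.val_succ] at h1
      exact Fin.ext (by rw [Fin.val_succ]; omega)
    have hφsum : ∀ F : Fin (d i + 1) → ℝ, ∑ a, phantomLaw α i p a * F a = F p.succ := by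
      intro F
      have hφ1 : phantomLaw α i p p.succ = 1 := by
        rwa [Finset.sum_eq_single p.succ (fun a _ ha => hφ0 a ha) (by simp)] at hφ
      rw [Finset.sum_eq_single p.succ (fun a _ ha => by rw [hφ0 a ha, zero_mul]) (by simp),
        hφ1, one_mul]
    have h1 : ∀ z, M.statDist α z * ∑ a, phantomLaw α i p a *
        (weight α i p z * (h z - h ⟨i, phantomAction i p z a⟩)) =
        -(Real.cos (α i p) * Real.sin (α i p)) *
          (visit i p.castSucc z * (M.statDist α z *
            (h z - h ⟨i, phantomAction i p z p.succ⟩)) -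
          visit i p.succ z * (M.statDist α z *
            (h z - h ⟨i, phantomAction i p z p.succ⟩))) := by
      intro z
      rw [hφsum, weight, if_neg hp]
      ring
    have h2 : phantomAction i p ⟨i, p.castSucc⟩ p.succ = p.succ := by
      simp [phantomAction]
    have h3 : phantomAction i p ⟨i, p.succ⟩ p.succ = p.castSucc := by
      simp [phantomAction, hp]
    have hlast : p.succ = Fin.last (d i) := Fin.ext (by
      have := p.2
      rw [Fin.val_succ, Fin.val_last]; omega)
    have h4 : M.statDist α ⟨i, p.succ⟩ =
        M.stateMass α i * (Real.sin (α i p) ^ 2 * sinSqProd α i p) := by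
      have hd : d i = p + 1 := by have := p.2; omega
      rw [statDist_eq hM, hlast, policy_last, ← sinSqProd_succ]
      congr 2
    simp_rw [h1]
    rw [← Finset.mul_sum, Finset.sum_sub_distrib, hvisit, hvisit, h2, h3, hφsum, h4,
      statDist_eq hM, policy_castSucc, Real.tan_eq_sin_div_cos]
    have hcs := Real.cos_sq_add_sin_sq (α i p)
    field_simp
    linear_combination (-(Real.sin (α i p) * M.stateMass α i * sinSqProd α i p *
      (h ⟨i, p.castSucc⟩ - h ⟨i, p.succ⟩))) * hcs

end Estimator

end MDP

/-! ### Consistency of the estimator. -/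

theorem mainTheorem1 {S : Type*} [Fintype S] [DecidableEq S] {d : S → ℕ}
    (M : MDP S d) (hM : M.IsErgodic)
    (α : MDP.Angles d) (hα : α ∈ interior (MDP.angleBox d))
    (c : MDP.StateAction d → ℝ)
    {Ω : Type*} [MeasurableSpace Ω] (μ : Measure Ω) [IsProbabilityMeasure μ]
    (Z : ℕ → Ω → MDP.StateAction d) (hZ : M.IsTrajectory α μ Z) :
    (∀ β ∈ interior (MDP.angleBox d), ∃! ϖ, M.IsInvariant β ϖ) ∧
    DifferentiableAt ℝ (M.statCost c) α ∧
    (∀ᵐ ω ∂μ, Tendsto (fun N : ℕ => 1 / (N : ℝ) * ∑ n ∈ Finset.Icc 1 N, c (Z n ω))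
      atTop (𝓝 (M.statCost c α))) ∧
    ∀ (i : S) (p : Fin (d i)) (Y : ℕ → Ω → Fin (d i + 1)),
      MDP.IsPhantomSequence α i p μ Z Y →
      (∀ᵐ ω ∂μ, ∀ k, (MDP.hittingSet i p (fun n => Z n ω) (fun n => Y n ω) k).Nonempty) ∧
      ∀ Γ : ℕ → Ω → ℝ,
        (∀ᵐ ω ∂μ, Tendsto (fun N => Γ N ω) atTop (𝓝 (M.statCost c α))) →
        ∀ᵐ ω ∂μ, Tendsto
          (fun N : ℕ => MDP.wdPhantom α c i p (fun n => Z n ω) (fun n => Y n ω) (Γ N ω) N)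
          atTop (𝓝 (fderiv ℝ (M.statCost c) α (Pi.single i (Pi.single p 1)))) := by
  have hne : Nonempty (MDP.StateAction d) := by
    obtain ⟨ω⟩ := nonempty_of_isProbabilityMeasure μ
    exact ⟨Z 0 ω⟩
  have hP := hM α hα
  have hs := M.kernel_sum α
  obtain ⟨hϖ, hinv⟩ := MDP.isInvariant_statDist hP
  have hchain := hZ.isFactorChain
  refine ⟨fun β hβ => MDP.existsUnique_isInvariant (hM β hβ),
    MDP.differentiableAt_statCost hM hα c,
    hchain.ae_tendsto_average hP hs hϖ hinv c, fun i p Y hY => ?_⟩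
  obtain ⟨hYm, hYlaw, hYi, hYZ⟩ := hY
  have hjoint := hchain.prodMk hYm hYZ
  refine ⟨?_, fun Γ hΓ => ?_⟩
  · filter_upwards [hjoint.ae_firstHit_le hP hs] with ω hω k
    exact hω.1 _ k
  have hφ : ∑ a, MDP.phantomLaw α i p a = 1 := by
    simp_rw [← hYlaw 0]
    have h1 := sum_measureReal_preimage_singleton (μ := μ) (f := Y 0) Finset.univ
      fun a _ => hYm 0 (MeasurableSet.of_discrete (s := {a}))
    have h2 : ∑ a, μ.real (Y 0 ⁻¹' {a}) = 1 := by simpa using h1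
    exact h2
  obtain ⟨h, hh⟩ := hP.exists_poisson hs hϖ hinv c
  have hlln := hchain.ae_tendsto_average_prod hP hs hϖ hinv hYm hYlaw hYi hYZ
  set T : MDP.StateAction d × Fin (d i + 1) → MDP.StateAction d :=
    fun b => ⟨i, MDP.phantomAction i p b.1 b.2⟩
  set q : MDP.StateAction d × Fin (d i + 1) → ℝ := fun b => MDP.weight α i p b.1
  -- The value of `l` is irrelevant: it is only multiplied by `Γ_N - C`, which tends to `0`.
  obtain ⟨l, hl⟩ := hjoint.exists_ae_tendsto_average_firstHit hP hs (fun g => ⟨_, hlln g⟩) T q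
  have hmain := hjoint.ae_tendsto_average_excursion hP hs hh T q
    (hlln fun b => q b * (h b.1 - h (T b)))
  rw [MDP.fderiv_statCost_single hM hα c hh, ← MDP.sum_weight_eq_deriv hP hα i p hφ]
  filter_upwards [hmain, hl, hΓ] with ω h1 h2 h3
  have h4 := (h1.const_mul 2).sub (((h3.sub_const (M.statCost c α)).mul h2).const_mul 2)
  rw [sub_self, zero_mul, mul_zero, sub_zero] at h4
  refine h4.congr fun N => ?_
  have hsum : ∀ ν : ℕ → ℝ, ∀ D : ℕ → ℝ, ∀ K : ℕ → ℝ,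
      2 * (1 / (N : ℝ) * ∑ k ∈ Finset.Ioc 0 N, K k * (D k - ν k * M.statCost c α)) -
        2 * ((Γ N ω - M.statCost c α) * (1 / (N : ℝ) * ∑ k ∈ Finset.Ioc 0 N, K k * ν k)) =
      2 / (N : ℝ) * ∑ k ∈ Finset.Ioc 0 N, K k * (D k - ν k * Γ N ω) := by
    intro ν D K
    simp_rw [mul_sub, Finset.sum_sub_distrib, ← mul_assoc, ← Finset.sum_mul]
    ring
  exact hsum _ _ _
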